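/- Let $\Omega\subset\mathbb R^d$, $d\in\{2,3\}$, be a bounded domain (in particular, it may be a polygonal or polyhedral one). Let $W=L^2(\Omega)$ with inner product $\langle\cdot,\cdot\rangle$, let $V=H(\mathrm{div};\Omega)=\{q\in L^2(\Omega)^d:\nabla\cdot q\in L^2(\Omega)\}$ with norm $(\|q\|^2+\|\nabla\cdot q\|^2)^{1/2}$, and let $H^1_0(\Omega)$ be the closure of $C_c^\infty(\Omega)$ in the $H^1$-norm. Let $D=(d_{ij})$ with $d_{ij}\in L^\infty(\Omega)$ be, for almost every $x\in\Omega$, symmetric with $D_m|\xi|^2\le \xi^\top D(x)\xi\le D_M|\xi|^2$ for all $\xi\in\mathbb R^d$, where $0<D_m\le D_M<\infty$, and put $a(u,v)=\langle D\nabla u,\nabla v\rangle$ for $u,v\in H^1_0(\Omega)$. Let $T>0$, $r\ge 1$, $0=t_0<t_1<\dots<t_N=T$, $f\in L^2(0,T;W)$ and $u_0\in H^1_0(\Omega)$. For a Hilbert space $X$ let $\mathcal X^r(X)$ be the space of all $u\in C([0,T];X)$ whose restriction to each $[t_{n-1},t_n]$ is a polynomial in $t$ of degree at most $r$ with coefficients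 in $X$, and let $\mathcal Y^{r-1}(X)$ be the space of all $w\in L^2(0,T;X)$ whose restriction to each $(t_{n-1},t_n]$ is a polynomial in $t$ of degree at most $r-1$ with coefficients in $X$. Then the following hold. 1. There is $u^0_\tau\in\mathcal X^r(H^1_0(\Omega))$ with $u^0_\tau(0)=0$ such that $$\int_0^T\langle\partial_t u^0_\tau,w_\tau\rangle\,dt+\int_0^T a(u^0_\tau,w_\tau)\,dt=\int_0^T \big(\langle f,w_\tau\rangle-a(u_0,w_\tau)\big)\,dt\qquad\text{for all } w_\tau\in\mathcal Y^{r-1}(H^1_0(\Omega)).$$ 2. There is $\tilde u_\tau\in\mathcal X^r(H^1_0(\Omega))$ with $\tilde u_\tau(0)=u_0$ such that $$\int_0^T\langle\partial_t \tilde u_\tau,w_\tau\rangle\,dt+\int_0^T a(\tilde u_\tau,w_\tau)\,dt=\int_0^T \langle f,w_\tau\rangle\,dt\qquad\text{for all } w_\tau\in\mathcal Y^{r-1}(H^1_0(\Omega)).$$ 3. If moreover $D\nabla u_0\in V$, then the semidiscrete mixed problem cGP($r$) has a solution: there is $\{u_\tau,q_\tau\}\in\mathcal X^r(W)\times\mathcal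 X^r(V)$ with $u_\tau(0)=u_0$ and $q_\tau(0)=-D\nabla u_0$ such that $$\int_0^T\langle\partial_t u_\tau,w_\tau\rangle\,dt+\int_0^T\langle\nabla\cdot q_\tau,w_\tau\rangle\,dt=\int_0^T\langle f,w_\tau\rangle\,dt,\qquad \int_0^T\langle D^{-1}q_\tau,v_\tau\rangle\,dt-\int_0^T\langle u_\tau,\nabla\cdot v_\tau\rangle\,dt=0$$ for all $w_\tau\in\mathcal Y^{r-1}(W)$ and $v_\tau\in\mathcal Y^{r-1}(V)$. This solution can be chosen as $u_\tau=\tilde u_\tau$, $q_\tau=-D\nabla\tilde u_\tau$ on $[0,T]$ with $\tilde u_\tau$ a solution of the problem in 2. -/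

import Mathlib

open MeasureTheory Set
open scoped ContDiff

noncomputable section

namespace CGPMixed

/-! ## Function spaces in space -/

/-- `ℝᵈ` with the Euclidean norm. -/
abbrev Euc (d : ℕ) : Type := EuclideanSpace ℝ (Fin d)

/-- `W = L²(Ω)`. -/
abbrev L2 {d : ℕ} (Ω : Set (Euc d)) : Type := Lp ℝ 2 (volume.restrict Ω)

/-- The space `L²(Ω)ᵈ` of square integrable vector fields. -/
abbrev L2Vec {d : ℕ} (Ω : Set (Euc d)) : Type := Lp (Euc d) 2 (volume.restrict Ω)

/-- The test functions `C_c^∞(Ω)`. -/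
structure TestFn {d : ℕ} (Ω : Set (Euc d)) where
  toFun : Euc d → ℝ
  smooth : ContDiff ℝ ∞ toFun
  compact : HasCompactSupport toFun
  supp : tsupport toFun ⊆ Ω

theorem TestFn.memLp {d : ℕ} {Ω : Set (Euc d)} (φ : TestFn Ω) :
    MemLp φ.toFun 2 (volume.restrict Ω) :=
  (φ.smooth.continuous.memLp_of_hasCompactSupport φ.compact).restrict Ω

theorem TestFn.grad_memLp {d : ℕ} {Ω : Set (Euc d)} (φ : TestFn Ω) :
    MemLp (gradient φ.toFun) 2 (volume.restrict Ω) := by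
  have hc : Continuous (gradient φ.toFun) :=
    (InnerProductSpace.toDual ℝ (Euc d)).symm.continuous.comp
      (φ.smooth.continuous_fderiv (by simp))
  have hs : HasCompactSupport (gradient φ.toFun) :=
    (φ.compact.fderiv (𝕜 := ℝ)).comp_left
      (g := (InnerProductSpace.toDual ℝ (Euc d)).symm) (map_zero _)
  exact (hc.memLp_of_hasCompactSupport hs).restrict Ω

/-- A test function as an element of `L²(Ω)`. -/
def TestFn.toL2 {d : ℕ} {Ω : Set (Euc d)} (φ : TestFn Ω) : L2 Ω := φ.memLp.toLp _

/-- The gradient of a test function as an element of `L²(Ω)ᵈ`. -/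
def TestFn.gradL2 {d : ℕ} {Ω : Set (Euc d)} (φ : TestFn Ω) : L2Vec Ω := φ.grad_memLp.toLp _

/-- `H¹₀(Ω)`, the closure of `C_c^∞(Ω)` in the `H¹`-norm `(‖u‖² + ‖∇u‖²)^{1/2}`. A function `u` is
represented by the pair `(u, ∇u)` in the Hilbert space `L²(Ω) × L²(Ω)ᵈ`; the subspace norm is
exactly the `H¹`-norm. -/
def H10 {d : ℕ} (Ω : Set (Euc d)) : Submodule ℝ (WithLp 2 (L2 Ω × L2Vec Ω)) :=
  (Submodule.span ℝ
    (range fun φ : TestFn Ω => WithLp.toLp 2 (φ.toL2, φ.gradL2))).topologicalClosure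

/-- The embedding `H¹₀(Ω) ⊂ L²(Ω)`. -/
def H10.val {d : ℕ} {Ω : Set (Euc d)} (u : H10 Ω) : L2 Ω := (u : WithLp 2 (L2 Ω × L2Vec Ω)).fst

/-- The weak gradient `∇u` of `u ∈ H¹₀(Ω)`. -/
def H10.grad {d : ℕ} {Ω : Set (Euc d)} (u : H10 Ω) : L2Vec Ω :=
  (u : WithLp 2 (L2 Ω × L2Vec Ω)).snd

/-- `g` is the weak divergence of `q` on `Ω`:
`⟨q, ∇φ⟩ = -⟨g, φ⟩` for all test functions `φ ∈ C_c^∞(Ω)`. -/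
def IsWeakDiv {d : ℕ} {Ω : Set (Euc d)} (q : L2Vec Ω) (g : L2 Ω) : Prop :=
  ∀ φ : TestFn Ω, inner ℝ q φ.gradL2 = -inner ℝ g φ.toL2

/-- `V = H(div; Ω)`, the fields `q ∈ L²(Ω)ᵈ` with a weak divergence in `L²(Ω)`. A field is
represented by the pair `(q, ∇ · q)` in the Hilbert space `L²(Ω)ᵈ × L²(Ω)`; the subspace norm is
exactly `(‖q‖² + ‖∇ · q‖²)^{1/2}`. -/
def Hdiv {d : ℕ} (Ω : Set (Euc d)) : Submodule ℝ (WithLp 2 (L2Vec Ω × L2 Ω)) where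
  carrier := {p | IsWeakDiv p.fst p.snd}
  add_mem' := by
    intro p q hp hq φ
    simp only [WithLp.add_fst, WithLp.add_snd, inner_add_left, hp φ, hq φ]
    ring
  zero_mem' := by
    intro φ
    simp
  smul_mem' := by
    intro c p hp φ
    simp only [WithLp.smul_fst, WithLp.smul_snd, inner_smul_left, hp φ]
    simp

/-- The embedding `H(div; Ω) ⊂ L²(Ω)ᵈ`. -/
def Hdiv.val {d : ℕ} {Ω : Set (Euc d)} (q : Hdiv Ω) : L2Vec Ω :=
  (q : WithLp 2 (L2Vec Ω × L2 Ω)).fst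

/-- The weak divergence `∇ · q` of `q ∈ H(div; Ω)`. -/
def Hdiv.div {d : ℕ} {Ω : Set (Euc d)} (q : Hdiv Ω) : L2 Ω :=
  (q : WithLp 2 (L2Vec Ω × L2 Ω)).snd

/-! ## The diffusion matrix -/

/-- The standing assumptions on the diffusion matrix: `D` has entries in `L^∞(Ω)`, and, for almost
every `x ∈ Ω`, `D(x)` is symmetric with `Dm |ξ|² ≤ ξᵀ D(x) ξ ≤ DM |ξ|²` for all `ξ`, where
`0 < Dm ≤ DM`. -/
structure IsDiffusionMatrix {d : ℕ} (Ω : Set (Euc d)) (D : Euc d → Matrix (Fin d) (Fin d) ℝ)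
    (Dm DM : ℝ) : Prop where
  pos : 0 < Dm
  le : Dm ≤ DM
  memLp : ∀ i j, MemLp (fun x => D x i j) ⊤ (volume.restrict Ω)
  symm : ∀ᵐ x ∂(volume.restrict Ω), (D x).IsSymm
  lower : ∀ᵐ x ∂(volume.restrict Ω), ∀ ξ : Euc d,
    Dm * ‖ξ‖ ^ 2 ≤ inner ℝ ξ (Matrix.toEuclideanLin (D x) ξ)
  upper : ∀ᵐ x ∂(volume.restrict Ω), ∀ ξ : Euc d,
    inner ℝ ξ (Matrix.toEuclideanLin (D x) ξ) ≤ DM * ‖ξ‖ ^ 2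

/-- `a(u, v) = ⟨D ∇u, ∇v⟩`. -/
def aForm {d : ℕ} {Ω : Set (Euc d)} (D : Euc d → Matrix (Fin d) (Fin d) ℝ) (u v : H10 Ω) : ℝ :=
  ∫ x in Ω, inner ℝ (Matrix.toEuclideanLin (D x) (H10.grad u x)) (H10.grad v x)

/-- `⟨D⁻¹ q, v⟩`. -/
def invForm {d : ℕ} {Ω : Set (Euc d)} (D : Euc d → Matrix (Fin d) (Fin d) ℝ)
    (q v : Hdiv Ω) : ℝ :=
  ∫ x in Ω, inner ℝ (Matrix.toEuclideanLin (D x)⁻¹ (Hdiv.val q x)) (Hdiv.val v x)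

/-- `q = -D ∇u` in `L²(Ω)ᵈ`. -/
def IsFlux {d : ℕ} {Ω : Set (Euc d)} (D : Euc d → Matrix (Fin d) (Fin d) ℝ)
    (q : Hdiv Ω) (u : H10 Ω) : Prop :=
  ∀ᵐ x ∂(volume.restrict Ω), Hdiv.val q x = -(Matrix.toEuclideanLin (D x) (H10.grad u x))

/-- `D ∇u ∈ H(div; Ω)`. -/
def FluxInHdiv {d : ℕ} {Ω : Set (Euc d)} (D : Euc d → Matrix (Fin d) (Fin d) ℝ)
    (u : H10 Ω) : Prop :=
  ∃ p : Hdiv Ω,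
    ∀ᵐ x ∂(volume.restrict Ω), Hdiv.val p x = Matrix.toEuclideanLin (D x) (H10.grad u x)

/-! ## Time mesh and piecewise polynomials in time -/

/-- `0 = t₀ < t₁ < ⋯ < t_N = T`. -/
structure IsTimeMesh {N : ℕ} (T : ℝ) (t : Fin (N + 1) → ℝ) : Prop where
  strictMono : StrictMono t
  first : t 0 = 0
  last : t (Fin.last N) = T

/-- `u` coincides on `J` with a polynomial in time of degree at most `r` with coefficients
in `X`. -/
def IsPolyOn {X : Type*} [AddCommGroup X] [Module ℝ X] (r : ℕ) (J : Set ℝ) (u : ℝ → X) : Prop :=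
  ∃ ξ : Fin (r + 1) → X, ∀ s ∈ J, u s = ∑ j : Fin (r + 1), s ^ (j : ℕ) • ξ j

/-- The trial space `X^r(X)`: functions in `C([0,T]; X)` that are polynomials of degree at most `r`
on each `[t_{n-1}, t_n]`. Only the values on `[0,T]` matter. -/
def IsTrial {X : Type*} [NormedAddCommGroup X] [NormedSpace ℝ X] {N : ℕ} (T : ℝ)
    (t : Fin (N + 1) → ℝ) (r : ℕ) (u : ℝ → X) : Prop :=
  ContinuousOn u (Icc 0 T) ∧ ∀ n : Fin N, IsPolyOn r (Icc (t n.castSucc) (t n.succ)) u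

/-- The test space `Y^r(X)`: functions in `L²(0,T; X)` that are polynomials of degree at most `r`
on each `(t_{n-1}, t_n]`. Only the values on `(0,T]` matter. -/
def IsTest {X : Type*} [NormedAddCommGroup X] [NormedSpace ℝ X] {N : ℕ} (T : ℝ)
    (t : Fin (N + 1) → ℝ) (r : ℕ) (w : ℝ → X) : Prop :=
  MemLp w 2 (volume.restrict (Ioc 0 T)) ∧
    ∀ n : Fin N, IsPolyOn r (Ioc (t n.castSucc) (t n.succ)) w

/-! ## The semidiscrete problems

The time derivative of a function of the trial space is the classical one, which exists off the
mesh points. -/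

/-- `u⁰ ∈ X^r(H¹₀)` with `u⁰(0) = 0` solves
`∫₀ᵀ ⟨∂ₜu⁰, w⟩ + ∫₀ᵀ a(u⁰, w) = ∫₀ᵀ ⟨f₀, w⟩` for all `w ∈ Y^{r-1}(H¹₀)`, where `f₀ = f - A u₀` and
`⟨A u₀, w⟩ = a(u₀, w)`. -/
structure IsShiftedPrimalSolution {d : ℕ} {Ω : Set (Euc d)}
    (D : Euc d → Matrix (Fin d) (Fin d) ℝ) {N : ℕ} (T : ℝ) (t : Fin (N + 1) → ℝ) (r : ℕ)
    (f : ℝ → L2 Ω) (u₀ : H10 Ω) (u : ℝ → H10 Ω) : Prop where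
  trial : IsTrial T t r u
  init : u 0 = 0
  eqn : ∀ w : ℝ → H10 Ω, IsTest T t (r - 1) w →
    (∫ s in (0 : ℝ)..T, inner ℝ (H10.val (deriv u s)) (H10.val (w s))) +
        (∫ s in (0 : ℝ)..T, aForm D (u s) (w s)) =
      ∫ s in (0 : ℝ)..T, (inner ℝ (f s) (H10.val (w s)) - aForm D u₀ (w s))

/-- `u ∈ X^r(H¹₀)` with `u(0) = u₀` solves
`∫₀ᵀ ⟨∂ₜu, w⟩ + ∫₀ᵀ a(u, w) = ∫₀ᵀ ⟨f, w⟩` for all `w ∈ Y^{r-1}(H¹₀)`. -/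
structure IsPrimalSolution {d : ℕ} {Ω : Set (Euc d)}
    (D : Euc d → Matrix (Fin d) (Fin d) ℝ) {N : ℕ} (T : ℝ) (t : Fin (N + 1) → ℝ) (r : ℕ)
    (f : ℝ → L2 Ω) (u₀ : H10 Ω) (u : ℝ → H10 Ω) : Prop where
  trial : IsTrial T t r u
  init : u 0 = u₀
  eqn : ∀ w : ℝ → H10 Ω, IsTest T t (r - 1) w →
    (∫ s in (0 : ℝ)..T, inner ℝ (H10.val (deriv u s)) (H10.val (w s))) +
        (∫ s in (0 : ℝ)..T, aForm D (u s) (w s)) =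
      ∫ s in (0 : ℝ)..T, inner ℝ (f s) (H10.val (w s))

/-- `{u, q} ∈ X^r(W) × X^r(V)` solves the mixed problem cGP(r):
`∫₀ᵀ ⟨∂ₜu, w⟩ + ∫₀ᵀ ⟨∇ · q, w⟩ = ∫₀ᵀ ⟨f, w⟩` for all `w ∈ Y^{r-1}(W)` and
`∫₀ᵀ ⟨D⁻¹ q, v⟩ - ∫₀ᵀ ⟨u, ∇ · v⟩ = 0` for all `v ∈ Y^{r-1}(V)`, with the initial conditions
`u(0) = u₀` and `q(0) = -D ∇u₀`. -/
structure IsMixedSolution {d : ℕ} {Ω : Set (Euc d)}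
    (D : Euc d → Matrix (Fin d) (Fin d) ℝ) {N : ℕ} (T : ℝ) (t : Fin (N + 1) → ℝ) (r : ℕ)
    (f : ℝ → L2 Ω) (u₀ : H10 Ω) (u : ℝ → L2 Ω) (q : ℝ → Hdiv Ω) : Prop where
  trial_u : IsTrial T t r u
  trial_q : IsTrial T t r q
  init_u : u 0 = H10.val u₀
  init_q : IsFlux D (q 0) u₀
  eqn_u : ∀ w : ℝ → L2 Ω, IsTest T t (r - 1) w →
    (∫ s in (0 : ℝ)..T, inner ℝ (deriv u s) (w s)) +
        (∫ s in (0 : ℝ)..T, inner ℝ (Hdiv.div (q s)) (w s)) =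
      ∫ s in (0 : ℝ)..T, inner ℝ (f s) (w s)
  eqn_q : ∀ v : ℝ → Hdiv Ω, IsTest T t (r - 1) v →
    (∫ s in (0 : ℝ)..T, invForm D (q s) (v s)) -
        (∫ s in (0 : ℝ)..T, inner ℝ (u s) (Hdiv.div (v s))) = 0

end CGPMixed

end

open CGPMixed

/-! The mixed problem is solved through the primal one, and the primal problem is solved on one mesh
interval `[a, b]` after the other.

On `[a, b]` let `Π` be the `L²(a, b)`-projection onto polynomials of degree at most `r - 1`. It is
a bijection from the polynomials of degree at most `r` that vanish at `a` onto the polynomials of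
degree at most `r - 1`: these spaces have the same dimension, and if `Π ((s - a) p) = 0` then
`∫ (s - a) p² = 0`, so that `p = 0`. Choosing an orthonormal basis `eₖ` of the latter space and its
preimages `gₖ` (`IsPetrovPair`, `exists_isPetrovPair`) and writing `u = u(a) + ∑ₖ gₖ vₖ`, the local
problem becomes the elliptic system
`∑ᵢ (∫ gᵢ' eₖ) ⟨vᵢ, w⟩ + a(vₖ, w) = ⟨∫ f eₖ, w⟩ - (∫ eₖ) a(u(a), w)` for the `vₖ ∈ H¹₀(Ω)`.
Testing `u` with `Π u` shows that it is coercive: since `∫ ⟨u', Π u⟩ = ∫ ⟨u', u⟩`, the first term is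
the complete square `‖∑ᵢ gᵢ(b) vᵢ‖² / 2`, and `a` is coercive on `H¹₀(Ω)` by Poincaré's inequality
(`H10.exists_norm_val_le`). Lax–Milgram applies (`exists_solution_of_coercive`). Subtracting `u₀`
from the solution with initial value `u₀` solves the shifted problem.

For the mixed problem, the system itself gives the regularity of the flux. If `D ∇u(a)` has a
divergence in `L²(Ω)`, then `a(vₖ, ·)` is represented by an element of `L²(Ω)`, so that `D ∇vₖ` is
in `H(div; Ω)`; hence `D ∇u(s)` is in `H(div; Ω)` on `[a, b]`, in particular at the next mesh point,
and induction over the mesh covers `[0, T]` (`exists_flux_of_isLocalSolution`). The flux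
`q = -D ∇u` is piecewise polynomial because weak divergences are unique. The first mixed equation
then holds against all of `L²(Ω)` by construction of the divergences, and the second is integration
by parts between `H(div; Ω)` and `H¹₀(Ω)` (`Hdiv.inner_grad`, `IsFlux.invForm_eq`). -/

namespace CGPMixed

/-! ### Polynomials in time adapted to the Galerkin–Petrov method -/

open Polynomial in
/-- The functional `p ↦ ∫ₐᵇ p` on real polynomials. -/
noncomputable def polyIntegral (a b : ℝ) : ℝ[X] →ₗ[ℝ] ℝ where
  toFun p := ∫ s in a..b, p.eval s
  map_add' p q := by
    simp only [Polynomial.eval_add]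
    exact intervalIntegral.integral_add (p.continuous.intervalIntegrable _ _)
      (q.continuous.intervalIntegrable _ _)
  map_smul' c p := by
    simp only [Polynomial.eval_smul, smul_eq_mul, RingHom.id_apply]
    exact intervalIntegral.integral_const_mul _ _

theorem polyIntegral_apply (a b : ℝ) (p : Polynomial ℝ) :
    polyIntegral a b p = ∫ s in a..b, p.eval s := rfl

theorem polyIntegral_derivative (a b : ℝ) (p : Polynomial ℝ) :
    polyIntegral a b (Polynomial.derivative p) = p.eval b - p.eval a := by
  rw [polyIntegral_apply]
  exact intervalIntegral.integral_eq_sub_of_hasDerivAt (fun s _ => p.hasDerivAt s)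
    ((Polynomial.derivative p).continuous.intervalIntegrable _ _)

theorem polyIntegral_pos {a b : ℝ} (hab : a < b) {p q : Polynomial ℝ} (hp : p ≠ 0)
    (hq : ∀ s ∈ Ioo a b, 0 < q.eval s) : 0 < polyIntegral a b (q * (p * p)) := by
  rw [polyIntegral_apply]
  have hcont : Continuous fun s => (q * (p * p)).eval s := (q * (p * p)).continuous
  have hnn : ∀ s ∈ Ioo a b, 0 ≤ (q * (p * p)).eval s := fun s hs => by
    rw [Polynomial.eval_mul, Polynomial.eval_mul]
    exact mul_nonneg (hq s hs).le (mul_self_nonneg _)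
  obtain ⟨c, hc, hcr⟩ := (Ioo_infinite hab).exists_notMem_finset p.roots.toFinset
  have hpc : p.eval c ≠ 0 := fun h => hcr (by simpa [hp] using h)
  refine intervalIntegral.integral_pos hab hcont.continuousOn ?_ ⟨c, Ioo_subset_Icc_self hc, ?_⟩
  · intro s hs
    have : Ioc a b ⊆ closure (Ioo a b) := by
      rw [closure_Ioo hab.ne]; exact Ioc_subset_Icc_self
    exact (isClosed_le continuous_const hcont).closure_subset_iff.2 hnn (this hs)
  · rw [Polynomial.eval_mul, Polynomial.eval_mul]
    exact mul_pos (hq c hc) (mul_self_pos.2 hpc)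

/-- Two families of polynomials adapted to the continuous Galerkin–Petrov method on `[a, b]`:
`e` spans the polynomials of degree at most `m`, and `g` is a family of polynomials of degree at
most `m + 1` vanishing at `a` and biorthogonal to `e`. When `e` is orthonormal, `dual` says that
`eₖ` is the `L²(a, b)`-projection of `gₖ`; the field `energy` records its consequence
`∫ gᵢ' eₖ = ∫ gᵢ' gₖ`, integrated by parts. -/
structure IsPetrovPair (a b : ℝ) (m : ℕ) (e g : Fin (m + 1) → Polynomial ℝ) : Prop where
  span : ∀ p : Polynomial ℝ, p.degree < (m + 1 : ℕ) →
    ∃ c : Fin (m + 1) → ℝ, p = ∑ k, c k • e k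
  dual : ∀ i k, polyIntegral a b (g i * e k) = if i = k then 1 else 0
  energy : ∀ i k, polyIntegral a b (Polynomial.derivative (g i) * e k) +
    polyIntegral a b (Polynomial.derivative (g k) * e i) = (g i).eval b * (g k).eval b
  natDegree_le : ∀ i, (g i).natDegree ≤ m + 1
  left : ∀ i, (g i).eval a = 0

theorem exists_orthonormal_basis_degreeLT {a b : ℝ} (hab : a < b) (m : ℕ) :
    ∃ e : Module.Basis (Fin (m + 1)) ℝ (Polynomial.degreeLT ℝ (m + 1)),
      ∀ i k, polyIntegral a b ((e i : Polynomial ℝ) * e k) = if i = k then 1 else 0 := by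
  let V := Polynomial.degreeLT ℝ (m + 1)
  let B : LinearMap.BilinForm ℝ V :=
    LinearMap.mk₂ ℝ (fun p q : V => polyIntegral a b ((p : Polynomial ℝ) * q))
      (fun p p' q => by simp [add_mul]) (fun c p q => by simp)
      (fun p q q' => by simp [mul_add]) (fun c p q => by simp)
  have hB : LinearMap.IsSymm B := ⟨fun p q => by simp [B, mul_comm]⟩
  have hfr : Module.finrank ℝ V = m + 1 := by
    rw [(Polynomial.degreeLTEquiv ℝ (m + 1)).finrank_eq]; simp
  have : FiniteDimensional ℝ V := (Polynomial.degreeLTEquiv ℝ (m + 1)).symm.finiteDimensional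
  have : Invertible (2 : ℝ) := invertibleOfNonzero two_ne_zero
  obtain ⟨v, hv⟩ := LinearMap.BilinForm.exists_orthogonal_basis (B := B) hB
  let v' := v.reindex (finCongr hfr)
  have hpos : ∀ i, 0 < polyIntegral a b ((v' i : Polynomial ℝ) * v' i) := fun i => by
    have h := polyIntegral_pos hab (p := (v' i : Polynomial ℝ)) (q := 1)
      (by simpa using v'.ne_zero i) (by simp)
    simpa using h
  have horth : ∀ i k, i ≠ k → polyIntegral a b ((v' i : Polynomial ℝ) * v' k) = 0 :=
    fun i k hik => by
      have := hv (i := (finCongr hfr).symm i) (j := (finCongr hfr).symm k) (by simpa using hik)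
      simpa [B, v'] using this
  refine ⟨v'.unitsSMul fun i => Units.mk0 (√(polyIntegral a b ((v' i : Polynomial ℝ) * v' i)))⁻¹
    (by have := hpos i; positivity), fun i k => ?_⟩
  rw [Module.Basis.unitsSMul_apply, Module.Basis.unitsSMul_apply]
  simp only [Units.smul_mk0, Submodule.coe_smul, smul_mul_assoc, mul_smul_comm, map_smul,
    smul_eq_mul]
  split_ifs with h
  · subst h
    have h1 := hpos i
    have h2 := Real.mul_self_sqrt h1.le
    have h3 : √(polyIntegral a b ((v' i : Polynomial ℝ) * v' i)) ≠ 0 := by positivity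
    nth_rewrite 3 [← h2]
    field_simp
  · rw [horth i k h]; simp

theorem exists_isPetrovPair {a b : ℝ} (hab : a < b) (m : ℕ) :
    ∃ e g : Fin (m + 1) → Polynomial ℝ, IsPetrovPair a b m e g := by
  obtain ⟨e, he⟩ := exists_orthonormal_basis_degreeLT hab m
  have hspan : ∀ p : Polynomial ℝ, p.degree < (m + 1 : ℕ) →
      ∃ c : Fin (m + 1) → ℝ, p = ∑ k, c k • (e k : Polynomial ℝ) := fun p hp => by
    refine ⟨e.repr ⟨p, Polynomial.mem_degreeLT.2 hp⟩, ?_⟩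
    have := congrArg (Polynomial.degreeLT ℝ (m + 1)).subtype
      (e.sum_repr ⟨p, Polynomial.mem_degreeLT.2 hp⟩)
    rw [map_sum] at this
    exact this.symm
  -- The moments of `(X - a) p` determine `p` of degree at most `m`: testing with `p` itself
  -- gives `∫ (s - a) p(s)² = 0`.
  let L : Polynomial.degreeLT ℝ (m + 1) →ₗ[ℝ] (Fin (m + 1) → ℝ) :=
    { toFun := fun p k => polyIntegral a b
        ((Polynomial.X - Polynomial.C a) * (p : Polynomial ℝ) * (e k : Polynomial ℝ))
      map_add' := fun p q => by ext k; simp [mul_add, add_mul]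
      map_smul' := fun c p => by ext k; simp }
  have hinj : Function.Injective L := by
    rw [← LinearMap.ker_eq_bot, LinearMap.ker_eq_bot']
    intro p hp
    by_contra hne
    obtain ⟨c, hc⟩ := hspan p (Polynomial.mem_degreeLT.1 p.2)
    have hpos := polyIntegral_pos hab (p := (p : Polynomial ℝ)) (by simpa using hne)
      (q := Polynomial.X - Polynomial.C a) (fun s hs => by simpa using hs.1)
    have : polyIntegral a b ((Polynomial.X - Polynomial.C a) *
        ((p : Polynomial ℝ) * (p : Polynomial ℝ))) = 0 := by
      rw [← mul_assoc]
      nth_rewrite 2 [hc]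
      rw [Finset.mul_sum, map_sum]
      refine Finset.sum_eq_zero fun k _ => ?_
      have := congrFun hp k
      simp only [L, LinearMap.coe_mk, AddHom.coe_mk, Pi.zero_apply] at this
      rw [mul_smul_comm, map_smul, this, smul_zero]
    exact hpos.ne' this
  have hsurj : Function.Surjective L :=
    (LinearMap.injective_iff_surjective_of_finrank_eq_finrank (by
      rw [(Polynomial.degreeLTEquiv ℝ (m + 1)).finrank_eq])).1 hinj
  choose p hp using fun i : Fin (m + 1) => hsurj (Pi.single i 1)
  let g : Fin (m + 1) → Polynomial ℝ := fun i => (Polynomial.X - Polynomial.C a) * (p i : Polynomial ℝ)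
  have hdual : ∀ i k, polyIntegral a b (g i * e k) = if i = k then 1 else 0 := fun i k => by
    have := congrFun (hp i) k
    simp only [L, LinearMap.coe_mk, AddHom.coe_mk, Pi.single_apply] at this
    simpa only [g, eq_comm] using this
  have hdeg : ∀ i, (g i).natDegree ≤ m + 1 := fun i => by
    have h1 : (p i : Polynomial ℝ).natDegree ≤ m := by
      have := Polynomial.mem_degreeLT.1 (p i).2
      exact Polynomial.natDegree_le_of_degree_le (Polynomial.degree_le_of_natDegree_le
        (Nat.lt_succ_iff.1 (by
          by_cases h0 : (p i : Polynomial ℝ) = 0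
          · simp [h0]
          · exact (Polynomial.natDegree_lt_iff_degree_lt h0).2 this)))
    refine Polynomial.natDegree_mul_le.trans ?_
    rw [Polynomial.natDegree_X_sub_C]; omega
  have hleft : ∀ i, (g i).eval a = 0 := fun i => by simp [g]
  -- `gᵢ'` has degree at most `m`, so `eₖ` may be replaced by `gₖ` when testing it.
  have hproj : ∀ i k, polyIntegral a b (Polynomial.derivative (g i) * e k) =
      polyIntegral a b (Polynomial.derivative (g i) * g k) := fun i k => by
    obtain ⟨c, hc⟩ := hspan (Polynomial.derivative (g i)) (by
      by_cases h0 : Polynomial.derivative (g i) = 0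
      · rw [h0, Polynomial.degree_zero]; exact WithBot.bot_lt_coe _
      · rw [← Polynomial.natDegree_lt_iff_degree_lt h0]
        have := Polynomial.natDegree_derivative_le (g i)
        have := hdeg i
        omega)
    rw [hc, Finset.sum_mul, Finset.sum_mul, map_sum, map_sum]
    refine Finset.sum_congr rfl fun l _ => ?_
    rw [smul_mul_assoc, smul_mul_assoc, map_smul, map_smul, he, mul_comm, hdual]
    simp [eq_comm]
  refine ⟨fun k => e k, g, hspan, hdual, fun i k => ?_, hdeg, hleft⟩
  rw [hproj i k, hproj k i, ← map_add, mul_comm (Polynomial.derivative (g k)),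
    ← Polynomial.derivative_mul, polyIntegral_derivative,
    Polynomial.eval_mul (p := g i), Polynomial.eval_mul (p := g i), hleft i]
  ring

/-! ### The coercive local system -/

/-- Lax–Milgram for the system `∑ᵢ Mᵢₖ j* j vᵢ + A vₖ = ℓₖ`, where the symmetric part of `M` is the
rank-one matrix `γ γᵀ / 2`, so that the first term contributes `‖∑ᵢ γᵢ j vᵢ‖² / 2 ≥ 0` to the
energy. -/
theorem exists_solution_of_coercive {H W : Type*} [NormedAddCommGroup H] [InnerProductSpace ℝ H]
    [CompleteSpace H] [NormedAddCommGroup W] [InnerProductSpace ℝ W] {ι : Type*} [Fintype ι]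
    (j : H →L[ℝ] W) (A : H →L[ℝ] H →L[ℝ] ℝ) (hA : IsCoercive A) (M : ι → ι → ℝ) (γ : ι → ℝ)
    (hM : ∀ i k, M i k + M k i = γ i * γ k) (ℓ : ι → H →L[ℝ] ℝ) :
    ∃ v : ι → H, ∀ k w, ∑ i, M i k * inner ℝ (j (v i)) (j w) + A (v k) w = ℓ k w := by
  classical
  let V := PiLp 2 (fun _ : ι => H)
  let pr : ι → V →L[ℝ] H := fun i => PiLp.proj 2 (fun _ : ι => H) i
  have hpr : ∀ i v, pr i v = v i := fun _ _ => rfl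
  let S : W →L[ℝ] W →L[ℝ] ℝ := innerSL ℝ
  let B : V →L[ℝ] V →L[ℝ] ℝ :=
    ∑ k, ((∑ i, M i k • S.bilinearComp (j ∘L pr i) (j ∘L pr k)) + A.bilinearComp (pr k) (pr k))
  have hBapp : ∀ v w : V, B v w =
      ∑ k, (∑ i, M i k * inner ℝ (j (v i)) (j (w k)) + A (v k) (w k)) := fun v w => by
    have hS : ∀ x y, S x y = inner ℝ x y := fun _ _ => rfl
    simp [B, hS, hpr]
  have hcoer : IsCoercive B := by
    obtain ⟨C, hC, hCA⟩ := hA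
    refine ⟨C, hC, fun v => ?_⟩
    have h1 : ∑ k, ∑ i, M i k * inner ℝ (j (v i)) (j (v k)) =
        (1 / 2) * ‖∑ i, γ i • j (v i)‖ ^ 2 := by
      have h2 : ∑ k, ∑ i, M k i * inner ℝ (j (v i)) (j (v k)) =
          ∑ k, ∑ i, M i k * inner ℝ (j (v i)) (j (v k)) := by
        rw [Finset.sum_comm]
        simp only [real_inner_comm]
      have h3 : ‖∑ i, γ i • j (v i)‖ ^ 2 =
          ∑ k, ∑ i, (M i k + M k i) * inner ℝ (j (v i)) (j (v k)) := by
        rw [← real_inner_self_eq_norm_sq, inner_sum]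
        refine Finset.sum_congr rfl fun k _ => ?_
        rw [sum_inner]
        refine Finset.sum_congr rfl fun i _ => ?_
        rw [real_inner_smul_left, real_inner_smul_right, hM]; ring
      rw [h3]
      simp only [add_mul, Finset.sum_add_distrib]
      rw [h2]; ring
    rw [hBapp, Finset.sum_add_distrib, h1]
    have h4 : C * ‖v‖ * ‖v‖ ≤ ∑ k, A (v k) (v k) := by
      rw [mul_assoc, ← sq, PiLp.norm_sq_eq_of_L2, Finset.mul_sum]
      refine Finset.sum_le_sum fun k _ => ?_
      rw [sq, ← mul_assoc]; exact hCA _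
    have h5 : 0 ≤ (1 / 2) * ‖∑ i, γ i • j (v i)‖ ^ 2 := by positivity
    linarith
  let L : V →L[ℝ] ℝ := ∑ k, ℓ k ∘L pr k
  let v : V := hcoer.continuousLinearEquivOfBilin.symm ((InnerProductSpace.toDual ℝ V).symm L)
  have hv : ∀ w, B v w = L w := fun w => by
    rw [← hcoer.continuousLinearEquivOfBilin_apply, ContinuousLinearEquiv.apply_symm_apply,
      InnerProductSpace.toDual_symm_apply]
  refine ⟨fun i => v i, fun k w => ?_⟩
  have h := hv (WithLp.toLp 2 (Pi.single k w))
  have hL : L (WithLp.toLp 2 (Pi.single k w)) = ℓ k w := by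
    have : L (WithLp.toLp 2 (Pi.single k w)) = ∑ i, ℓ i ((Pi.single k w : ι → H) i) := by
      simp only [L, sum_apply, ContinuousLinearMap.comp_apply, hpr]
    rw [this, Finset.sum_eq_single k (fun l _ hl => by simp [Pi.single_eq_of_ne hl]) (by simp),
      Pi.single_eq_same]
  rw [hBapp, hL, Finset.sum_eq_single k (fun l _ hl => by simp [Pi.single_eq_of_ne hl])
    (by simp)] at h
  simpa using h

/-! ### Piecewise polynomials in time -/

theorem IsPolyOn.congr {X : Type*} [AddCommGroup X] [Module ℝ X] {r : ℕ} {J : Set ℝ}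
    {u v : ℝ → X} (hu : IsPolyOn r J u) (huv : EqOn v u J) : IsPolyOn r J v := by
  obtain ⟨ξ, hξ⟩ := hu
  exact ⟨ξ, fun s hs => (huv hs).trans (hξ s hs)⟩

theorem isPolyOn_add_sum_eval_smul {X : Type*} [AddCommGroup X] [Module ℝ X] {r : ℕ}
    {ι : Type*} [Fintype ι] {g : ι → Polynomial ℝ} (hg : ∀ i, (g i).natDegree ≤ r) (J : Set ℝ)
    (x : X) (v : ι → X) : IsPolyOn r J fun s => x + ∑ i, (g i).eval s • v i := by
  refine ⟨fun k => (if k = 0 then x else 0) + ∑ i, (g i).coeff k • v i, fun s _ => ?_⟩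
  simp only [smul_add, Finset.sum_add_distrib, smul_ite, smul_zero, Finset.smul_sum]
  congr 1
  · simp
  · rw [Finset.sum_comm]
    refine Finset.sum_congr rfl fun i _ => ?_
    rw [Polynomial.eval_eq_sum_range' (Nat.lt_succ_of_le (hg i)), ← Fin.sum_univ_eq_sum_range
      (fun k => (g i).coeff k * s ^ k), Finset.sum_smul]
    refine Finset.sum_congr rfl fun k _ => ?_
    rw [smul_smul, mul_comm]

theorem IsPolyOn.continuousOn {X : Type*} [NormedAddCommGroup X] [NormedSpace ℝ X] {r : ℕ}
    {J : Set ℝ} {u : ℝ → X} (hu : IsPolyOn r J u) : ContinuousOn u J := by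
  obtain ⟨ξ, hξ⟩ := hu
  refine ContinuousOn.congr (f := fun s => ∑ k : Fin (r + 1), s ^ (k : ℕ) • ξ k) ?_ hξ
  fun_prop

theorem IsTimeMesh.exists_mem_Icc {N : ℕ} {T : ℝ} {t : Fin (N + 1) → ℝ} (ht : IsTimeMesh T t)
    (hT : 0 < T) {s : ℝ} (hs : s ∈ Icc 0 T) :
    ∃ n : Fin N, s ∈ Icc (t n.castSucc) (t n.succ) := by
  have key : ∀ k : Fin (N + 1), s ≤ t k → k ≠ 0 →
      ∃ n : Fin N, s ∈ Icc (t n.castSucc) (t n.succ) := by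
    intro k
    induction k using Fin.induction with
    | zero => exact fun _ h => absurd rfl h
    | succ k ih =>
      intro hk _
      by_cases h : t k.castSucc ≤ s
      · exact ⟨k, h, hk⟩
      · refine ih (not_le.1 h).le fun h0 => h ?_
        rw [h0, ht.first]; exact hs.1
  refine key (Fin.last N) (by rw [ht.last]; exact hs.2) fun h => ?_
  have := ht.last
  rw [h, ht.first] at this
  exact hT.ne this

/-- A function that is a polynomial on every closed mesh interval is continuous, since neighbouring
polynomials agree at the common mesh point. -/
theorem IsTimeMesh.isTrial {X : Type*} [NormedAddCommGroup X] [NormedSpace ℝ X] {N : ℕ} {T : ℝ}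
    {t : Fin (N + 1) → ℝ} (ht : IsTimeMesh T t) (hT : 0 < T) {r : ℕ} {u : ℝ → X}
    (hu : ∀ n : Fin N, IsPolyOn r (Icc (t n.castSucc) (t n.succ)) u) : IsTrial T t r u := by
  refine ⟨?_, hu⟩
  refine ((locallyFinite_of_finite fun n : Fin N =>
    Icc (t n.castSucc) (t n.succ)).continuousOn_iUnion (fun _ => isClosed_Icc)
      fun n => (hu n).continuousOn).mono fun s hs => ?_
  exact mem_iUnion.2 (ht.exists_mem_Icc hT hs)

/-- Time stepping: a local property `Q n` that, on the `n`-th mesh interval, can be achieved from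
every initial value is achieved on all mesh intervals by one function. -/
theorem exists_timeStepping {X : Type*} {N : ℕ} {t : Fin (N + 1) → ℝ} (ht : StrictMono t)
    (Q : Fin N → (ℝ → X) → Prop)
    (hcongr : ∀ n y z, EqOn y z (Icc (t n.castSucc) (t n.succ)) → Q n y → Q n z)
    (hstep : ∀ n x, ∃ y, y (t n.castSucc) = x ∧ Q n y) (x : X) :
    ∃ y, y (t 0) = x ∧ ∀ n, Q n y := by
  suffices h : ∀ k : Fin (N + 1), ∃ y, y (t 0) = x ∧ ∀ n : Fin N, n.succ ≤ k → Q n y by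
    obtain ⟨y, hy0, hy⟩ := h (Fin.last N)
    exact ⟨y, hy0, fun n => hy n (Fin.le_last _)⟩
  intro k
  induction k using Fin.induction with
  | zero => exact ⟨fun _ => x, rfl, fun n hn => absurd hn (by simp)⟩
  | succ k ih =>
    obtain ⟨y, hy0, hy⟩ := ih
    obtain ⟨z, hz0, hz⟩ := hstep k (y (t k.castSucc))
    refine ⟨fun s => if s ≤ t k.castSucc then y s else z s, ?_, fun n hn => ?_⟩
    · simp [ht.monotone (Fin.zero_le k.castSucc), hy0]
    · rcases (Fin.succ_le_succ_iff.1 hn).eq_or_lt with rfl | hlt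
      · refine hcongr n z _ (fun s hs => ?_) hz
        by_cases h : s ≤ t n.castSucc
        · simp [le_antisymm h hs.1, hz0]
        · simp [h]
      · refine hcongr n y _ (fun s hs => ?_) (hy n (Fin.succ_le_castSucc_iff.2 hlt))
        simp [hs.2.trans (ht.monotone (Fin.succ_le_castSucc_iff.2 hlt))]

theorem IsTimeMesh.sum_intervalIntegral {N : ℕ} {T : ℝ} {t : Fin (N + 1) → ℝ}
    (ht : IsTimeMesh T t) {p : ℝ → ℝ}
    (hp : ∀ n : Fin N, IntervalIntegrable p volume (t n.castSucc) (t n.succ)) :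
    IntervalIntegrable p volume 0 T ∧
      ∑ n : Fin N, ∫ s in (t n.castSucc)..(t n.succ), p s = ∫ s in (0 : ℝ)..T, p s := by
  let τ : ℕ → ℝ := fun k => t ⟨min k N, by omega⟩
  have h0 : τ 0 = 0 := by simpa [τ] using ht.first
  have hN : τ N = T := by simpa [τ, Fin.last] using ht.last
  have hc : ∀ n : Fin N, τ n = t n.castSucc := fun n => congrArg t (Fin.ext (by simp [n.2.le]))
  have hs : ∀ n : Fin N, τ (n + 1) = t n.succ := fun n =>
    congrArg t (Fin.ext (by simp [Nat.succ_le_of_lt n.2]))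
  have hint : ∀ k < N, IntervalIntegrable p volume (τ k) (τ (k + 1)) := fun k hk => by
    have := hp ⟨k, hk⟩
    rwa [← hc, ← hs] at this
  refine ⟨by simpa only [h0, hN] using IntervalIntegrable.trans_iterate hint, ?_⟩
  rw [← h0, ← hN, ← intervalIntegral.sum_integral_adjacent_intervals hint,
    ← Fin.sum_univ_eq_sum_range (fun k => ∫ s in (τ k)..(τ (k + 1)), p s)]
  exact Finset.sum_congr rfl fun n _ => by rw [hc, hs]

/-! ### Local problems -/

/-- An equation tested with the products `eₖ ⊗ κ` on one mesh interval holds for all polynomial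
test functions of degree at most `m`. -/
theorem IsPetrovPair.integral_eq {a b : ℝ} (hab : a < b) {m : ℕ}
    {e g : Fin (m + 1) → Polynomial ℝ} (heg : IsPetrovPair a b m e g)
    {K W Y : Type*} [NormedAddCommGroup K] [NormedSpace ℝ K] [NormedAddCommGroup W]
    [InnerProductSpace ℝ W] [CompleteSpace W] [NormedAddCommGroup Y] [NormedSpace ℝ Y]
    (J : K →L[ℝ] W) (B : Y →L[ℝ] K →L[ℝ] ℝ) {dU f : ℝ → W} {U : ℝ → Y} {w : ℝ → K}
    {v : Fin (m + 1) → W} {y : Fin (m + 1) → Y} {x : Y}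
    (hdU : ∀ s ∈ Ioo a b, dU s = ∑ i, (Polynomial.derivative (g i)).eval s • v i)
    (hU : ∀ s ∈ Ioo a b, U s = x + ∑ i, (g i).eval s • y i)
    (hw : IsPolyOn m (Ioc a b) w) (hf : IntervalIntegrable f volume a b)
    (heq : ∀ k κ, ∑ i, polyIntegral a b (Polynomial.derivative (g i) * e k) *
        inner ℝ (v i) (J κ) + polyIntegral a b (e k) * B x κ + B (y k) κ =
      inner ℝ (∫ s in a..b, (e k).eval s • f s) (J κ)) :
    IntervalIntegrable (fun s => inner ℝ (dU s) (J (w s))) volume a b ∧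
    IntervalIntegrable (fun s => B (U s) (w s)) volume a b ∧
    IntervalIntegrable (fun s => inner ℝ (f s) (J (w s))) volume a b ∧
    (∫ s in a..b, inner ℝ (dU s) (J (w s))) + (∫ s in a..b, B (U s) (w s)) =
      ∫ s in a..b, inner ℝ (f s) (J (w s)) := by
  -- the expansion of `w` in the basis `e`
  obtain ⟨η, hη⟩ : ∃ η : Fin (m + 1) → K, ∀ s ∈ Ioo a b, w s = ∑ k, (e k).eval s • η k := by
    obtain ⟨ξ, hξ⟩ := hw
    choose c hc using fun l : Fin (m + 1) => heg.span (Polynomial.X ^ (l : ℕ)) (by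
      rw [Polynomial.degree_X_pow]; exact_mod_cast l.2)
    refine ⟨fun k => ∑ l, c l k • ξ l, fun s hs => ?_⟩
    rw [hξ s (Ioo_subset_Ioc_self hs)]
    simp only [Finset.smul_sum]
    rw [Finset.sum_comm]
    refine Finset.sum_congr rfl fun l _ => ?_
    have := congrArg (Polynomial.eval s) (hc l)
    rw [Polynomial.eval_pow, Polynomial.eval_X, Polynomial.eval_finsetSum] at this
    rw [this, Finset.sum_smul]
    refine Finset.sum_congr rfl fun k _ => ?_
    rw [smul_smul, Polynomial.eval_smul, smul_eq_mul, mul_comm]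
  -- the first two integrands are polynomials
  let P₁ : Polynomial ℝ :=
    ∑ k, ∑ i, (inner ℝ (v i) (J (η k)) : ℝ) • (Polynomial.derivative (g i) * e k)
  let P₂ : Polynomial ℝ :=
    ∑ k, (B x (η k) • e k + ∑ i, B (y i) (η k) • (g i * e k))
  have h₁ : EqOn (fun s => P₁.eval s) (fun s => inner ℝ (dU s) (J (w s))) (Ioo a b) := by
    intro s hs
    simp only [P₁, hdU s hs, hη s hs, map_sum, map_smul, inner_sum, sum_inner,
      real_inner_smul_left, real_inner_smul_right, Polynomial.eval_finsetSum,
      Polynomial.eval_smul, Polynomial.eval_mul, smul_eq_mul]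
    refine Finset.sum_congr rfl fun k _ => Finset.sum_congr rfl fun i _ => ?_
    ring
  have h₂ : EqOn (fun s => P₂.eval s) (fun s => B (U s) (w s)) (Ioo a b) := by
    intro s hs
    simp only [P₂, hU s hs, hη s hs, map_sum, map_smul, map_add, add_apply,
      sum_apply, smul_apply, Polynomial.eval_finsetSum, Polynomial.eval_add,
      Polynomial.eval_smul, Polynomial.eval_mul, smul_eq_mul]
    refine Finset.sum_congr rfl fun k _ => ?_
    rw [mul_add, Finset.mul_sum]
    congr 1
    · ring
    · refine Finset.sum_congr rfl fun i _ => ?_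
      ring
  have hek : ∀ k, IntervalIntegrable (fun s => (e k).eval s • f s) volume a b := fun k =>
    hf.continuousOn_smul (e k).continuous.continuousOn
  have hekη : ∀ k κ, IntervalIntegrable (fun s => inner ℝ ((e k).eval s • f s) κ) volume a b :=
    fun k κ => ⟨(hek k).1.inner_const κ, (hek k).2.inner_const κ⟩
  have h₃ : EqOn (fun s => ∑ k, inner ℝ ((e k).eval s • f s) (J (η k)))
      (fun s => inner ℝ (f s) (J (w s))) (Ioo a b) := by
    intro s hs
    simp only [hη s hs, map_sum, map_smul, inner_sum, real_inner_smul_left,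
      real_inner_smul_right]
  have hu : uIoo a b = Ioo a b := uIoo_of_le hab.le
  refine ⟨(P₁.continuous.intervalIntegrable a b).congr_uIoo (hu ▸ h₁),
    (P₂.continuous.intervalIntegrable a b).congr_uIoo (hu ▸ h₂),
    (IntervalIntegrable.sum _ fun k _ => hekη k (J (η k))).congr_uIoo
      (by simpa only [hu, Finset.sum_fn] using h₃), ?_⟩
  rw [← intervalIntegral.integral_congr_Ioo_of_le hab.le h₁,
    ← intervalIntegral.integral_congr_Ioo_of_le hab.le h₂,
    ← intervalIntegral.integral_congr_Ioo_of_le hab.le h₃, ← polyIntegral_apply,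
    ← polyIntegral_apply, intervalIntegral.integral_finsetSum fun k _ => hekη k (J (η k)),
    ← map_add]
  simp only [P₁, P₂, ← Finset.sum_add_distrib, map_sum, map_add, map_smul, smul_eq_mul, heg.dual,
    mul_ite, mul_one, mul_zero]
  refine Finset.sum_congr rfl fun k _ => ?_
  have h₄ : ∫ s in a..b, (inner ℝ ((e k).eval s • f s) (J (η k)) : ℝ) =
      inner ℝ (∫ s in a..b, (e k).eval s • f s) (J (η k)) := by
    simp only [real_inner_comm (J (η k))]
    exact (innerSL ℝ (J (η k))).intervalIntegral_comp_comm (hek k)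
  rw [h₄, ← heq, Finset.sum_ite_eq' Finset.univ k, if_pos (Finset.mem_univ k), add_assoc]
  congr 1
  · exact Finset.sum_congr rfl fun i _ => mul_comm _ _
  · rw [mul_comm]

/-- The local Galerkin–Petrov equations on the mesh interval `[a, b]`, in terms of the coefficients
of `y - y(a)` with respect to the family `g`. -/
def IsLocalSolution {H W : Type*} [NormedAddCommGroup H] [NormedSpace ℝ H]
    [NormedAddCommGroup W] [InnerProductSpace ℝ W] (j : H →L[ℝ] W) (A : H →L[ℝ] H →L[ℝ] ℝ)
    (f : ℝ → W) (a b : ℝ) {m : ℕ} (e g : Fin (m + 1) → Polynomial ℝ) (y : ℝ → H) : Prop :=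
  ∃ v : Fin (m + 1) → H, (∀ s ∈ Icc a b, y s = y a + ∑ i, (g i).eval s • v i) ∧
    ∀ k w, ∑ i, polyIntegral a b (Polynomial.derivative (g i) * e k) *
        inner ℝ (j (v i)) (j w) + polyIntegral a b (e k) * A (y a) w + A (v k) w =
      inner ℝ (∫ s in a..b, (e k).eval s • f s) (j w)

theorem exists_isLocalSolution {H W : Type*} [NormedAddCommGroup H] [InnerProductSpace ℝ H]
    [CompleteSpace H] [NormedAddCommGroup W] [InnerProductSpace ℝ W] (j : H →L[ℝ] W)
    (A : H →L[ℝ] H →L[ℝ] ℝ) (hA : IsCoercive A) (f : ℝ → W) {a b : ℝ} {m : ℕ}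
    {e g : Fin (m + 1) → Polynomial ℝ} (heg : IsPetrovPair a b m e g) (x : H) :
    ∃ y, y a = x ∧ IsLocalSolution j A f a b e g y := by
  let ℓ : Fin (m + 1) → H →L[ℝ] ℝ := fun k =>
    (innerSL ℝ (∫ s in a..b, (e k).eval s • f s)) ∘L j - polyIntegral a b (e k) • A x
  obtain ⟨v, hv⟩ := exists_solution_of_coercive j A hA
    (fun i k => polyIntegral a b (Polynomial.derivative (g i) * e k)) (fun i => (g i).eval b)
    heg.energy ℓ
  have ha : x + ∑ i, (g i).eval a • v i = x := by simp [heg.left]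
  refine ⟨fun s => x + ∑ i, (g i).eval s • v i, ha, v, fun s _ => by simp only [ha],
    fun k w => ?_⟩
  have := hv k w
  simp only [ℓ, sub_apply, smul_apply, ContinuousLinearMap.comp_apply, innerSL_apply_apply,
    smul_eq_mul] at this
  simp only [ha]
  linarith

/-- The derivative of a function that is of the form `x + ∑ᵢ gᵢ vᵢ` on an interval, followed by a
continuous linear map. -/
theorem deriv_of_eq_add_sum {H : Type*} [NormedAddCommGroup H] [NormedSpace ℝ H]
    {a b : ℝ} {ι : Type*} [Fintype ι] {g : ι → Polynomial ℝ}
    {y : ℝ → H} {x : H} {v : ι → H}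
    (hy : ∀ s ∈ Icc a b, y s = x + ∑ i, (g i).eval s • v i) {s : ℝ} (hs : s ∈ Ioo a b) :
    deriv y s = ∑ i, (Polynomial.derivative (g i)).eval s • v i := by
  have h : HasDerivAt (fun s => x + ∑ i, (g i).eval s • v i)
      (∑ i, (Polynomial.derivative (g i)).eval s • v i) s :=
    (HasDerivAt.fun_sum fun i _ => ((g i).hasDerivAt s).smul_const (v i)).const_add x
  refine (h.congr_of_eventuallyEq ?_).deriv
  filter_upwards [Icc_mem_nhds hs.1 hs.2] with z hz using hy z hz

/-! ### The spaces `H¹₀(Ω)` and `H(div; Ω)` -/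

section Spaces

variable {d : ℕ} {Ω : Set (Euc d)}

instance : CompleteSpace (H10 Ω) :=
  (Submodule.isClosed_topologicalClosure _).completeSpace_coe

/-- `u ↦ u` as a continuous linear map `H¹₀(Ω) → L²(Ω)`. -/
noncomputable def H10.valL (Ω : Set (Euc d)) : H10 Ω →L[ℝ] L2 Ω :=
  WithLp.fstL 2 ℝ (L2 Ω) (L2Vec Ω) ∘L (H10 Ω).subtypeL

/-- The weak gradient as a continuous linear map `H¹₀(Ω) → L²(Ω)ᵈ`. -/
noncomputable def H10.gradL (Ω : Set (Euc d)) : H10 Ω →L[ℝ] L2Vec Ω :=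
  WithLp.sndL 2 ℝ (L2 Ω) (L2Vec Ω) ∘L (H10 Ω).subtypeL

/-- The weak divergence as a continuous linear map `H(div; Ω) → L²(Ω)`. -/
noncomputable def Hdiv.divL (Ω : Set (Euc d)) : Hdiv Ω →L[ℝ] L2 Ω :=
  WithLp.sndL 2 ℝ (L2Vec Ω) (L2 Ω) ∘L (Hdiv Ω).subtypeL

/-- `q ↦ q` as a continuous linear map `H(div; Ω) → L²(Ω)ᵈ`. -/
noncomputable def Hdiv.valL (Ω : Set (Euc d)) : Hdiv Ω →L[ℝ] L2Vec Ω :=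
  WithLp.fstL 2 ℝ (L2Vec Ω) (L2 Ω) ∘L (Hdiv Ω).subtypeL

theorem H10.valL_apply (u : H10 Ω) : H10.valL Ω u = H10.val u := rfl

theorem H10.gradL_apply (u : H10 Ω) : H10.gradL Ω u = H10.grad u := rfl

theorem Hdiv.valL_apply (q : Hdiv Ω) : Hdiv.valL Ω q = Hdiv.val q := rfl

/-- A test function as an element of `H¹₀(Ω)`. -/
noncomputable def TestFn.toH10 (φ : TestFn Ω) : H10 Ω :=
  ⟨WithLp.toLp 2 (φ.toL2, φ.gradL2),
    Submodule.le_topologicalClosure _ (Submodule.subset_span ⟨φ, rfl⟩)⟩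

/-- The test functions form a linear subspace of `H¹₀(Ω)`. -/
theorem TestFn.mem_span_iff (u : H10 Ω) :
    u ∈ Submodule.span ℝ (range (TestFn.toH10 (Ω := Ω))) ↔ ∃ φ : TestFn Ω, φ.toH10 = u := by
  refine ⟨fun hu => ?_, fun ⟨φ, hφ⟩ => Submodule.subset_span ⟨φ, hφ⟩⟩
  -- two elements of `H¹₀(Ω)` agree as soon as both components agree almost everywhere
  have hext : ∀ (φ : TestFn Ω) (u : H10 Ω), φ.toFun =ᵐ[volume.restrict Ω] H10.val u →
      gradient φ.toFun =ᵐ[volume.restrict Ω] H10.grad u → φ.toH10 = u := fun φ u h1 h2 =>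
    Subtype.ext ((WithLp.ofLp_injective 2) (Prod.ext
      (Lp.ext (φ.memLp.coeFn_toLp.trans h1)) (Lp.ext (φ.grad_memLp.coeFn_toLp.trans h2))))
  have hval : ∀ φ : TestFn Ω, H10.val φ.toH10 =ᵐ[volume.restrict Ω] φ.toFun := fun φ =>
    φ.memLp.coeFn_toLp
  have hgrad : ∀ φ : TestFn Ω, H10.grad φ.toH10 =ᵐ[volume.restrict Ω] gradient φ.toFun :=
    fun φ => φ.grad_memLp.coeFn_toLp
  have hdiff : ∀ φ : TestFn Ω, Differentiable ℝ φ.toFun := fun φ =>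
    φ.smooth.differentiable (by simp)
  induction hu using Submodule.span_induction with
  | mem u hu => exact hu
  | zero =>
    let φ : TestFn Ω := ⟨fun _ => 0, contDiff_const, HasCompactSupport.zero, by simp [tsupport]⟩
    refine ⟨φ, hext φ 0 ?_ ?_⟩
    · filter_upwards [Lp.coeFn_zero ℝ 2 (volume.restrict Ω)] with x hx
      exact hx.symm
    · filter_upwards [Lp.coeFn_zero (Euc d) 2 (volume.restrict Ω)] with x hx
      refine Eq.trans ?_ hx.symm
      simp [φ, gradient]
  | add u w _ _ hu hw =>
    obtain ⟨φ, rfl⟩ := hu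
    obtain ⟨ψ, rfl⟩ := hw
    let χ : TestFn Ω := ⟨fun x => φ.toFun x + ψ.toFun x, φ.smooth.add ψ.smooth,
      φ.compact.add ψ.compact,
      (tsupport_add _ _).trans (union_subset φ.supp ψ.supp)⟩
    refine ⟨χ, hext χ _ ?_ ?_⟩
    · filter_upwards [Lp.coeFn_add (H10.val φ.toH10) (H10.val ψ.toH10), hval φ, hval ψ]
        with x h1 h2 h3
      refine Eq.trans ?_ h1.symm
      rw [Pi.add_apply, h2, h3]
    · filter_upwards [Lp.coeFn_add (H10.grad φ.toH10) (H10.grad ψ.toH10), hgrad φ, hgrad ψ]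
        with x h1 h2 h3
      refine Eq.trans ?_ h1.symm
      rw [Pi.add_apply, h2, h3]
      simp only [χ, gradient]
      rw [fderiv_fun_add (hdiff φ x) (hdiff ψ x), map_add]
  | smul c u _ hu =>
    obtain ⟨φ, rfl⟩ := hu
    let χ : TestFn Ω := ⟨fun x => c * φ.toFun x, contDiff_const.mul φ.smooth,
      HasCompactSupport.mul_left φ.compact,
      (closure_mono (Function.support_mul_subset_right (fun _ => c) φ.toFun)).trans φ.supp⟩
    refine ⟨χ, hext χ _ ?_ ?_⟩
    · filter_upwards [Lp.coeFn_smul c (H10.val φ.toH10), hval φ] with x h1 h2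
      refine Eq.trans ?_ h1.symm
      rw [Pi.smul_apply, h2, smul_eq_mul]
    · filter_upwards [Lp.coeFn_smul c (H10.grad φ.toH10), hgrad φ] with x h1 h2
      refine Eq.trans ?_ h1.symm
      rw [Pi.smul_apply, h2]
      simp only [χ, gradient]
      rw [fderiv_const_mul (hdiff φ x), map_smul]

/-- Density of the test functions in `H¹₀(Ω)`, as an induction principle for closed properties. -/
theorem H10.induction_on_testFn {P : H10 Ω → Prop} (hclosed : IsClosed {u | P u})
    (htest : ∀ φ : TestFn Ω, P φ.toH10) (u : H10 Ω) : P u := by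
  have hdense : u ∈ closure (Submodule.span ℝ (range (TestFn.toH10 (Ω := Ω))) : Set (H10 Ω)) := by
    rw [Topology.IsInducing.subtypeVal.closure_eq_preimage_closure_image, mem_preimage]
    have himg : (Subtype.val '' (Submodule.span ℝ (range (TestFn.toH10 (Ω := Ω))) :
        Set (H10 Ω))) = (Submodule.span ℝ
          (range fun φ : TestFn Ω => WithLp.toLp 2 (φ.toL2, φ.gradL2)) :
            Set (WithLp 2 (L2 Ω × L2Vec Ω))) := by
      have := Submodule.map_span (H10 Ω).subtype (range (TestFn.toH10 (Ω := Ω)))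
      rw [← range_comp] at this
      exact congrArg (fun S : Submodule ℝ _ => (S : Set (WithLp 2 (L2 Ω × L2Vec Ω)))) this
    change (u : WithLp 2 (L2 Ω × L2Vec Ω)) ∈ closure (Subtype.val ''
      (Submodule.span ℝ (range (TestFn.toH10 (Ω := Ω))) : Set (H10 Ω)))
    rw [himg]
    exact u.2
  refine hclosed.closure_subset_iff.2 (fun w hw => ?_) hdense
  obtain ⟨φ, rfl⟩ := (TestFn.mem_span_iff w).1 hw
  exact htest φ

/-- A function in `L²(Ω)` orthogonal to all test functions vanishes. -/
theorem eq_zero_of_inner_testFn (hΩ : IsOpen Ω) (h : L2 Ω)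
    (hh : ∀ φ : TestFn Ω, inner ℝ h φ.toL2 = 0) : h = 0 := by
  have hloc : LocallyIntegrableOn h Ω volume :=
    locallyIntegrableOn_of_locallyIntegrable_restrict
      ((Lp.memLp h).locallyIntegrable (by norm_num))
  have hae := hΩ.ae_eq_zero_of_integral_contDiff_smul_eq_zero hloc fun g hg hgc hgs => by
    let φ : TestFn Ω := ⟨g, hg, hgc, hgs⟩
    have h1 := hh φ
    rw [L2.inner_def] at h1
    have h2 : ∫ x in Ω, g x • h x = ∫ x, g x • h x :=
      setIntegral_eq_integral_of_forall_compl_eq_zero fun x hx => by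
        rw [image_eq_zero_of_notMem_tsupport fun h' => hx (hgs h'), zero_smul]
    rw [← h2, ← h1]
    refine integral_congr_ae ?_
    filter_upwards [φ.memLp.coeFn_toLp] with x hx
    change _ = inner ℝ (h x) ((φ.memLp.toLp _ : L2 Ω) x)
    rw [hx]
    simp [φ]
  rw [Lp.eq_zero_iff_ae_eq_zero]
  exact (ae_restrict_iff' hΩ.measurableSet).2 hae

/-- Integration by parts, `(q, ∇u) = -(∇ · q, u)` for `q ∈ H(div; Ω)` and `u ∈ H¹₀(Ω)`. -/
theorem Hdiv.inner_grad (q : Hdiv Ω) (u : H10 Ω) :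
    inner ℝ (Hdiv.val q) (H10.grad u) = -inner ℝ (Hdiv.div q) (H10.val u) := by
  refine H10.induction_on_testFn (P := fun u => (inner ℝ (Hdiv.val q) (H10.grad u) : ℝ) =
    -inner ℝ (Hdiv.div q) (H10.val u)) ?_ (fun φ => q.2 φ) u
  simp only [← H10.gradL_apply, ← H10.valL_apply]
  exact isClosed_eq (by fun_prop) (by fun_prop)

/-- The weak divergence of a field is unique. -/
theorem Hdiv.ext_val (hΩ : IsOpen Ω) {p q : Hdiv Ω} (h : Hdiv.val p = Hdiv.val q) : p = q := by
  have hdiv : Hdiv.div p = Hdiv.div q := by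
    rw [← sub_eq_zero]
    refine eq_zero_of_inner_testFn hΩ _ fun φ => ?_
    have hp := p.2 φ
    have hq := q.2 φ
    change inner ℝ (Hdiv.val p) _ = -inner ℝ (Hdiv.div p) _ at hp
    change inner ℝ (Hdiv.val q) _ = -inner ℝ (Hdiv.div q) _ at hq
    rw [inner_sub_left]
    rw [h] at hp
    linarith
  apply Subtype.ext
  exact (WithLp.ofLp_injective 2) (Prod.ext h hdiv)

/-- Integration of `φ² = φ² ∂ᵥc` by parts, for a linear function `c` with `∂ᵥc = 1`. -/
theorem TestFn.integral_mul_self (φ : TestFn Ω) (c : Euc d →L[ℝ] ℝ) {v : Euc d} (hcv : c v = 1) :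
    ∫ x, φ.toFun x * φ.toFun x = -2 * ∫ x, c x * (φ.toFun x * fderiv ℝ φ.toFun x v) := by
  have hφc : Continuous φ.toFun := φ.smooth.continuous
  have hφd : Differentiable ℝ φ.toFun := φ.smooth.differentiable (by simp)
  have hφd' : Continuous (fderiv ℝ φ.toFun) := φ.smooth.continuous_fderiv (by simp)
  have hD : ∀ x, fderiv ℝ (fun x => φ.toFun x * φ.toFun x) x v =
      2 * (φ.toFun x * fderiv ℝ φ.toFun x v) := fun x => by
    rw [fderiv_fun_mul (hφd x) (hφd x)]
    simp only [add_apply, smul_apply, smul_eq_mul]; ring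
  have hcs : HasCompactSupport fun x => φ.toFun x * φ.toFun x := φ.compact.mul_right
  have hcs' : HasCompactSupport fun x => φ.toFun x * fderiv ℝ φ.toFun x v := φ.compact.mul_right
  have hc' : Continuous fun x => φ.toFun x * fderiv ℝ φ.toFun x v :=
    hφc.mul (hφd'.clm_apply continuous_const)
  have i1 : Integrable (fun x => fderiv ℝ (fun x => c x) x v * (φ.toFun x * φ.toFun x)) := by
    simp only [ContinuousLinearMap.fderiv, hcv, one_mul]
    exact (hφc.mul hφc).integrable_of_hasCompactSupport hcs
  have i2 : Integrable
      (fun x => c x * fderiv ℝ (fun x => φ.toFun x * φ.toFun x) x v) := by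
    simp only [hD]
    exact (c.continuous.mul (continuous_const.mul hc')).integrable_of_hasCompactSupport
      (hcs'.mul_left.mul_left)
  have i3 : Integrable (fun x => c x * (φ.toFun x * φ.toFun x)) :=
    (c.continuous.mul (hφc.mul hφc)).integrable_of_hasCompactSupport hcs.mul_left
  have hint := integral_mul_fderiv_eq_neg_fderiv_mul_of_integrable i1 i2 i3
    (fun x _ => c.differentiableAt) (fun x _ => (hφd x).mul (hφd x))
  simp only [hD, ContinuousLinearMap.fderiv, hcv, one_mul] at hint
  rw [← neg_eq_iff_eq_neg.2 hint, ← integral_const_mul, ← integral_neg]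
  refine integral_congr_ae (Filter.Eventually.of_forall fun x => ?_)
  simp only; ring

theorem TestFn.norm_toL2_sq (φ : TestFn Ω) :
    ‖φ.toL2‖ ^ 2 = ∫ x, φ.toFun x * φ.toFun x := by
  have h : ∫ x in Ω, φ.toFun x * φ.toFun x = ∫ x, φ.toFun x * φ.toFun x :=
    setIntegral_eq_integral_of_forall_compl_eq_zero fun x hx => by
      rw [image_eq_zero_of_notMem_tsupport fun h' => hx (φ.supp h'), zero_mul]
  rw [← real_inner_self_eq_norm_sq, L2.inner_def, ← h]
  refine integral_congr_ae ?_
  filter_upwards [φ.memLp.coeFn_toLp] with x hx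
  change inner ℝ ((φ.memLp.toLp _ : L2 Ω) x) ((φ.memLp.toLp _ : L2 Ω) x) = _
  rw [hx]
  rfl

/-- Poincaré's inequality for test functions: integrating `φ² = φ² ∂₀x₀` by parts gives
`‖φ‖² = -2 (x₀ φ, ∂₀φ)`. -/
theorem TestFn.norm_toL2_le (hd : 0 < d) {R : ℝ} (hR0 : 0 ≤ R) (hR : ∀ x ∈ Ω, ‖x‖ ≤ R)
    (hΩ : IsOpen Ω) (φ : TestFn Ω) : ‖φ.toL2‖ ≤ 2 * R * ‖φ.gradL2‖ := by
  let i₀ : Fin d := ⟨0, hd⟩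
  let v : Euc d := EuclideanSpace.single i₀ 1
  have hv : ‖v‖ = 1 := by simp [v]
  let c : Euc d →L[ℝ] ℝ := EuclideanSpace.proj i₀
  have hcv : c v = 1 := by simp [c, v]
  have hc_le : ∀ x, ‖c x‖ ≤ ‖x‖ := fun x => PiLp.norm_apply_le x i₀
  have hXc : Continuous fun x => (c x * φ.toFun x) • v :=
    (c.continuous.mul φ.smooth.continuous).smul continuous_const
  have hXs : HasCompactSupport fun x => (c x * φ.toFun x) • v :=
    HasCompactSupport.comp_left (f := fun x => c x * φ.toFun x) (g := fun r => r • v)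
      (HasCompactSupport.mul_left φ.compact) (zero_smul ℝ v)
  have hXm : MemLp (fun x => (c x * φ.toFun x) • v) 2 (volume.restrict Ω) :=
    (hXc.memLp_of_hasCompactSupport hXs).restrict Ω
  have hX : ‖(hXm.toLp _ : L2Vec Ω)‖ ≤ R * ‖φ.toL2‖ := by
    refine Lp.norm_le_mul_norm_of_ae_le_mul (f := hXm.toLp _) (g := φ.toL2) ?_
    filter_upwards [hXm.coeFn_toLp, φ.memLp.coeFn_toLp,
      ae_restrict_mem hΩ.measurableSet] with x h1 h2 hx
    change _ ≤ R * ‖(φ.memLp.toLp _ : L2 Ω) x‖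
    rw [h1, h2, norm_smul, hv, mul_one, norm_mul]
    exact mul_le_mul_of_nonneg_right ((hc_le x).trans (hR x hx)) (norm_nonneg _)
  have hin : inner ℝ (hXm.toLp _ : L2Vec Ω) φ.gradL2 =
      ∫ x, c x * (φ.toFun x * fderiv ℝ φ.toFun x v) := by
    have h : ∫ x in Ω, c x * (φ.toFun x * fderiv ℝ φ.toFun x v) =
        ∫ x, c x * (φ.toFun x * fderiv ℝ φ.toFun x v) :=
      setIntegral_eq_integral_of_forall_compl_eq_zero fun x hx => by
        rw [image_eq_zero_of_notMem_tsupport fun h' => hx (φ.supp h'), zero_mul, mul_zero]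
    rw [L2.inner_def, ← h]
    refine integral_congr_ae ?_
    filter_upwards [hXm.coeFn_toLp, φ.grad_memLp.coeFn_toLp] with x h1 h2
    change inner ℝ _ ((φ.grad_memLp.toLp _ : L2Vec Ω) x) = _
    rw [h1, h2, real_inner_smul_left, real_inner_comm, inner_gradient_left]
    ring
  have hle : ‖φ.toL2‖ * ‖φ.toL2‖ ≤ 2 * R * ‖φ.gradL2‖ * ‖φ.toL2‖ := by
    rw [← sq, φ.norm_toL2_sq, φ.integral_mul_self c hcv, ← hin]
    have h2 := neg_le_of_abs_le (abs_real_inner_le_norm (hXm.toLp _ : L2Vec Ω) φ.gradL2)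
    have h3 := mul_le_mul_of_nonneg_right hX (norm_nonneg φ.gradL2)
    linarith
  rcases (norm_nonneg φ.toL2).eq_or_lt with h0 | h0
  · rw [← h0]
    positivity
  · exact le_of_mul_le_mul_right hle h0

/-- Poincaré's inequality on `H¹₀(Ω)` for bounded `Ω`. -/
theorem H10.exists_norm_val_le (hd : 0 < d) (hΩ : IsOpen Ω) (hΩb : Bornology.IsBounded Ω) :
    ∃ C : ℝ, 0 ≤ C ∧ ∀ u : H10 Ω, ‖H10.val u‖ ≤ C * ‖H10.grad u‖ := by
  obtain ⟨R, hR0, hR⟩ := hΩb.exists_pos_norm_le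
  refine ⟨2 * R, by positivity, fun u => ?_⟩
  refine H10.induction_on_testFn (P := fun u => ‖H10.val u‖ ≤ 2 * R * ‖H10.grad u‖) ?_
    (fun φ => φ.norm_toL2_le hd hR0.le hR hΩ) u
  simp only [← H10.gradL_apply, ← H10.valL_apply]
  exact isClosed_le (by fun_prop) (by fun_prop)

/-! ### The diffusion operator -/

theorem memLp_sum_smul {α E ι : Type*} [MeasurableSpace α] {μ : Measure α}
    [NormedAddCommGroup E] [NormedSpace ℝ E] [Fintype ι] {p : ENNReal} {f : ι → α → ℝ}
    (hf : ∀ i, MemLp (f i) p μ) (F : ι → E) : MemLp (fun x => ∑ i, f i x • F i) p μ := by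
  refine memLp_finsetSum _ fun i _ => ?_
  exact (ContinuousLinearMap.toSpanSingleton ℝ (F i)).comp_memLp' (hf i)

/-- Multiplication by the diffusion matrix is a bounded operator on `L²(Ω)ᵈ`. -/
theorem IsDiffusionMatrix.exists_operator {D : Euc d → Matrix (Fin d) (Fin d) ℝ} {Dm DM : ℝ}
    (hD : IsDiffusionMatrix Ω D Dm DM) : ∃ M : L2Vec Ω →L[ℝ] L2Vec Ω, ∀ q,
      ∀ᵐ x ∂(volume.restrict Ω), M q x = Matrix.toEuclideanLin (D x) (q x) := by
  have hmem : MemLp (fun x => Matrix.toEuclideanCLM (𝕜 := ℝ) (D x)) ⊤ (volume.restrict Ω) := by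
    have hsum : (fun x => Matrix.toEuclideanCLM (𝕜 := ℝ) (D x)) = fun x => ∑ i : Fin d × Fin d,
        D x i.1 i.2 • Matrix.toEuclideanCLM (𝕜 := ℝ) (Matrix.single i.1 i.2 (1 : ℝ)) := by
      ext1 x
      conv_lhs => rw [Matrix.matrix_eq_sum_single (D x)]
      simp only [map_sum, Fintype.sum_prod_type]
      refine Finset.sum_congr rfl fun i _ => Finset.sum_congr rfl fun j _ => ?_
      rw [← map_smul, Matrix.smul_single, smul_eq_mul, mul_one]
    rw [hsum]
    exact memLp_sum_smul (f := fun (i : Fin d × Fin d) x => D x i.1 i.2)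
      (fun i => hD.memLp i.1 i.2) _
  refine ⟨(ContinuousLinearMap.id ℝ (Euc d →L[ℝ] Euc d)).holderL _ ⊤ 2 2 (hmem.toLp _),
    fun q => ?_⟩
  filter_upwards [(ContinuousLinearMap.id ℝ (Euc d →L[ℝ] Euc d)).coeFn_holder (r := 2)
    (hmem.toLp _) q, hmem.coeFn_toLp] with x h1 h2
  rw [ContinuousLinearMap.holderL_apply_apply, h1, h2]
  rfl

theorem IsDiffusionMatrix.isCoercive {D : Euc d → Matrix (Fin d) (Fin d) ℝ} {Dm DM : ℝ}
    (hD : IsDiffusionMatrix Ω D Dm DM) (hd : 0 < d) (hΩ : IsOpen Ω)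
    (hΩb : Bornology.IsBounded Ω) {A : H10 Ω →L[ℝ] H10 Ω →L[ℝ] ℝ}
    (hA : ∀ u w, A u w = aForm D u w) : IsCoercive A := by
  obtain ⟨C, hC, hP⟩ := H10.exists_norm_val_le hd hΩ hΩb
  obtain ⟨M, hM⟩ := hD.exists_operator
  have hDm := hD.pos
  refine ⟨Dm / (C ^ 2 + 1), by positivity, fun u => ?_⟩
  have h1 : Dm * ‖H10.grad u‖ ^ 2 ≤ A u u := by
    rw [hA, ← real_inner_self_eq_norm_sq, L2.inner_def, ← integral_const_mul, aForm]
    refine integral_mono_ae ((L2.integrable_inner _ _).const_mul _) ?_ ?_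
    · refine (L2.integrable_inner (𝕜 := ℝ) (M (H10.grad u)) (H10.grad u)).congr ?_
      filter_upwards [hM (H10.grad u)] with x hx
      rw [hx]
    · filter_upwards [hD.lower] with x hx
      have := hx (H10.grad u x)
      rw [← real_inner_self_eq_norm_sq] at this
      exact this.trans_eq (real_inner_comm _ _)
  have h2 : ‖u‖ ^ 2 = ‖H10.val u‖ ^ 2 + ‖H10.grad u‖ ^ 2 :=
    WithLp.prod_norm_sq_eq_of_L2 (u : WithLp 2 (L2 Ω × L2Vec Ω))
  have h3 : ‖u‖ ^ 2 ≤ (C ^ 2 + 1) * ‖H10.grad u‖ ^ 2 := by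
    have := pow_le_pow_left₀ (norm_nonneg _) (hP u) 2
    rw [mul_pow] at this
    linarith
  refine le_trans ?_ h1
  rw [mul_assoc, ← sq, div_mul_eq_mul_div, div_le_iff₀ (by positivity), mul_assoc]
  exact mul_le_mul_of_nonneg_left (by linarith) hDm.le

theorem aForm_eq_inner {D : Euc d → Matrix (Fin d) (Fin d) ℝ} {M : L2Vec Ω →L[ℝ] L2Vec Ω}
    (hM : ∀ q, ∀ᵐ x ∂(volume.restrict Ω), M q x = Matrix.toEuclideanLin (D x) (q x))
    (u w : H10 Ω) : aForm D u w = inner ℝ (M (H10.grad u)) (H10.grad w) := by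
  rw [L2.inner_def, aForm]
  refine integral_congr_ae ?_
  filter_upwards [hM (H10.grad u)] with x hx
  rw [hx]

theorem isFlux_iff {D : Euc d → Matrix (Fin d) (Fin d) ℝ} {M : L2Vec Ω →L[ℝ] L2Vec Ω}
    (hM : ∀ q, ∀ᵐ x ∂(volume.restrict Ω), M q x = Matrix.toEuclideanLin (D x) (q x))
    {q : Hdiv Ω} {u : H10 Ω} : IsFlux D q u ↔ Hdiv.val q = -M (H10.grad u) := by
  constructor
  · intro h
    refine Lp.ext ?_
    filter_upwards [h, hM (H10.grad u), Lp.coeFn_neg (M (H10.grad u))] with x h1 h2 h3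
    rw [h1, h3, Pi.neg_apply, h2]
  · intro h
    rw [IsFlux, h]
    filter_upwards [hM (H10.grad u), Lp.coeFn_neg (M (H10.grad u))] with x h2 h3
    rw [h3, Pi.neg_apply, h2]

/-- The second equation of the mixed problem at a fixed time: the flux `q = -D ∇u` satisfies
`(D⁻¹ q, v) = -(∇u, v) = (u, ∇ · v)`. -/
theorem IsFlux.invForm_eq {D : Euc d → Matrix (Fin d) (Fin d) ℝ} {Dm DM : ℝ}
    (hD : IsDiffusionMatrix Ω D Dm DM) {q : Hdiv Ω} {u : H10 Ω} (hq : IsFlux D q u)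
    (v : Hdiv Ω) : invForm D q v = inner ℝ (H10.val u) (Hdiv.div v) := by
  have h1 : invForm D q v = -inner ℝ (Hdiv.val v) (H10.grad u) := by
    rw [L2.inner_def, invForm, ← integral_neg]
    refine integral_congr_ae ?_
    filter_upwards [hq, hD.lower] with x hx hl
    have hinj : Function.Injective (D x).mulVec := by
      intro ξ ζ hξ
      have h0 : Matrix.toEuclideanLin (D x) (WithLp.toLp 2 (ξ - ζ)) = 0 := by
        rw [Matrix.toLpLin_apply, Matrix.mulVec_sub, hξ, sub_self]
        rfl
      have := hl (WithLp.toLp 2 (ξ - ζ))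
      rw [h0, inner_zero_right] at this
      have h2 : ‖(WithLp.toLp 2 (ξ - ζ) : Euc d)‖ ^ 2 ≤ 0 :=
        nonpos_of_mul_nonpos_right this hD.pos
      have h3 : (WithLp.toLp 2 (ξ - ζ) : Euc d) = 0 := by
        rw [← norm_eq_zero]
        exact pow_eq_zero_iff two_ne_zero |>.1 (le_antisymm h2 (sq_nonneg _))
      exact sub_eq_zero.1 (congrArg WithLp.ofLp h3)
    have hunit := Matrix.mulVec_injective_iff_isUnit.1 hinj
    have hinv : Matrix.toEuclideanLin (D x)⁻¹ (Hdiv.val q x) = -H10.grad u x := by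
      rw [hx, map_neg, Matrix.toLpLin_apply, Matrix.toLpLin_apply,
        Matrix.mulVec_mulVec, Matrix.nonsing_inv_mul _ ((Matrix.isUnit_iff_isUnit_det _).1 hunit),
        Matrix.one_mulVec]
    rw [hinv, inner_neg_left, real_inner_comm]
  rw [h1, Hdiv.inner_grad, neg_neg, real_inner_comm]

end Spaces

/-! ### Assembling the semidiscrete problems -/

theorem IsLocalSolution.congr {H W : Type*} [NormedAddCommGroup H] [NormedSpace ℝ H]
    [NormedAddCommGroup W] [InnerProductSpace ℝ W] {j : H →L[ℝ] W} {A : H →L[ℝ] H →L[ℝ] ℝ}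
    {f : ℝ → W} {a b : ℝ} (hab : a ≤ b) {m : ℕ} {e g : Fin (m + 1) → Polynomial ℝ} {y z : ℝ → H}
    (hyz : EqOn y z (Icc a b)) (hy : IsLocalSolution j A f a b e g y) :
    IsLocalSolution j A f a b e g z := by
  obtain ⟨v, h1, h2⟩ := hy
  rw [hyz (left_mem_Icc.2 hab)] at h1 h2
  exact ⟨v, fun s hs => by rw [← hyz hs, h1 s hs], h2⟩

theorem IsLocalSolution.isPolyOn {H W : Type*} [NormedAddCommGroup H] [NormedSpace ℝ H]
    [NormedAddCommGroup W] [InnerProductSpace ℝ W] {j : H →L[ℝ] W} {A : H →L[ℝ] H →L[ℝ] ℝ}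
    {f : ℝ → W} {a b : ℝ} {m : ℕ} {e g : Fin (m + 1) → Polynomial ℝ}
    (heg : IsPetrovPair a b m e g) {y : ℝ → H} (hy : IsLocalSolution j A f a b e g y) :
    IsPolyOn (m + 1) (Icc a b) y := by
  obtain ⟨v, h1, -⟩ := hy
  exact (isPolyOn_add_sum_eval_smul heg.natDegree_le _ (y a) v).congr h1

theorem IsTimeMesh.add_integral_eq {N : ℕ} {T : ℝ} {t : Fin (N + 1) → ℝ}
    (ht : IsTimeMesh T t) {p q h : ℝ → ℝ}
    (hn : ∀ n : Fin N, IntervalIntegrable p volume (t n.castSucc) (t n.succ) ∧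
      IntervalIntegrable q volume (t n.castSucc) (t n.succ) ∧
      IntervalIntegrable h volume (t n.castSucc) (t n.succ) ∧
      (∫ s in (t n.castSucc)..(t n.succ), p s) + (∫ s in (t n.castSucc)..(t n.succ), q s) =
        ∫ s in (t n.castSucc)..(t n.succ), h s) :
    IntervalIntegrable q volume 0 T ∧ IntervalIntegrable h volume 0 T ∧
      (∫ s in (0 : ℝ)..T, p s) + (∫ s in (0 : ℝ)..T, q s) = ∫ s in (0 : ℝ)..T, h s := by
  obtain ⟨-, hp⟩ := ht.sum_intervalIntegral fun n => (hn n).1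
  obtain ⟨hq', hq⟩ := ht.sum_intervalIntegral fun n => (hn n).2.1
  obtain ⟨hh', hh⟩ := ht.sum_intervalIntegral fun n => (hn n).2.2.1
  refine ⟨hq', hh', ?_⟩
  rw [← hp, ← hq, ← hh, ← Finset.sum_add_distrib]
  exact Finset.sum_congr rfl fun n _ => (hn n).2.2.2

theorem IsTimeMesh.Icc_subset {N : ℕ} {T : ℝ} {t : Fin (N + 1) → ℝ} (ht : IsTimeMesh T t)
    (n : Fin N) : Icc (t n.castSucc) (t n.succ) ⊆ Icc 0 T := by
  rw [← ht.first, ← ht.last]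
  exact Icc_subset_Icc (ht.strictMono.monotone (Fin.zero_le _))
    (ht.strictMono.monotone (Fin.le_last _))

theorem IsTimeMesh.lt {N : ℕ} {T : ℝ} {t : Fin (N + 1) → ℝ} (ht : IsTimeMesh T t) (n : Fin N) :
    t n.castSucc < t n.succ := ht.strictMono n.castSucc_lt_succ

theorem IsTimeMesh.intervalIntegrable {W : Type*} [NormedAddCommGroup W] {N : ℕ} {T : ℝ}
    {t : Fin (N + 1) → ℝ} (ht : IsTimeMesh T t) {f : ℝ → W}
    (hf : MemLp f 2 (volume.restrict (Ioc 0 T))) (n : Fin N) :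
    IntervalIntegrable f volume (t n.castSucc) (t n.succ) := by
  rw [intervalIntegrable_iff_integrableOn_Ioc_of_le (ht.lt n).le]
  have h : IntegrableOn f (Ioc 0 T) := hf.integrable (by norm_num)
  rw [← ht.first, ← ht.last] at h
  exact h.mono_set (Ioc_subset_Ioc (ht.strictMono.monotone (Fin.zero_le _))
    (ht.strictMono.monotone (Fin.le_last _)))

/-- The local equations add up to the global variational equation of the primal problem. -/
theorem integral_eq_of_isLocalSolution {H W : Type*} [NormedAddCommGroup H] [NormedSpace ℝ H]
    [NormedAddCommGroup W] [InnerProductSpace ℝ W] [CompleteSpace W] {j : H →L[ℝ] W}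
    {A : H →L[ℝ] H →L[ℝ] ℝ} {f : ℝ → W} {N m : ℕ} {T : ℝ} {t : Fin (N + 1) → ℝ}
    (ht : IsTimeMesh T t) (hf : MemLp f 2 (volume.restrict (Ioc 0 T)))
    {e g : Fin N → Fin (m + 1) → Polynomial ℝ}
    (heg : ∀ n, IsPetrovPair (t n.castSucc) (t n.succ) m (e n) (g n)) {y : ℝ → H}
    (hy : ∀ n, IsLocalSolution j A f (t n.castSucc) (t n.succ) (e n) (g n) y) {w : ℝ → H}
    (hw : IsTest T t m w) :
    IntervalIntegrable (fun s => A (y s) (w s)) volume 0 T ∧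
      IntervalIntegrable (fun s => inner ℝ (f s) (j (w s))) volume 0 T ∧
      (∫ s in (0 : ℝ)..T, inner ℝ (j (deriv y s)) (j (w s))) + (∫ s in (0 : ℝ)..T, A (y s) (w s)) =
        ∫ s in (0 : ℝ)..T, inner ℝ (f s) (j (w s)) := by
  refine ht.add_integral_eq fun n => ?_
  obtain ⟨v, h1, h2⟩ := hy n
  refine (heg n).integral_eq (ht.lt n) j A (dU := fun s => j (deriv y s)) (v := fun i => j (v i))
    (fun s hs => ?_) (fun s hs => h1 s (Ioo_subset_Icc_self hs)) (hw.2 n)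
    (ht.intervalIntegrable hf n) h2
  simp only [deriv_of_eq_add_sum h1 hs, map_sum, map_smul]

section Mixed

variable {d : ℕ} {Ω : Set (Euc d)}

/-- Elliptic regularity of the coefficients of a local solution: if the initial value has a flux
`qₐ` in `H(div; Ω)`, then so have the coefficients `vₖ`, because the equation tested with `eₖ`
exhibits `-∇ · (D ∇vₖ)` as an element of `L²(Ω)`. -/
theorem IsLocalSolution.exists_flux {M : L2Vec Ω →L[ℝ] L2Vec Ω}
    {A : H10 Ω →L[ℝ] H10 Ω →L[ℝ] ℝ}
    (hA : ∀ u w, A u w = inner ℝ (M (H10.grad u)) (H10.grad w))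
    {f : ℝ → L2 Ω} {a b : ℝ} {m : ℕ} {e g : Fin (m + 1) → Polynomial ℝ} {y : ℝ → H10 Ω}
    (hy : IsLocalSolution (H10.valL Ω) A f a b e g y) {qa : Hdiv Ω}
    (hqa : Hdiv.val qa = -M (H10.grad (y a))) :
    ∃ (v : Fin (m + 1) → H10 Ω) (q : Fin (m + 1) → Hdiv Ω),
      (∀ s ∈ Icc a b, y s = y a + ∑ i, (g i).eval s • v i) ∧
      (∀ s ∈ Icc a b, Hdiv.val (qa + ∑ i, (g i).eval s • q i) = -M (H10.grad (y s))) ∧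
      ∀ k κ, ∑ i, polyIntegral a b (Polynomial.derivative (g i) * e k) *
          inner ℝ (H10.val (v i)) κ + polyIntegral a b (e k) * inner ℝ (Hdiv.div qa) κ +
            inner ℝ (Hdiv.div (q k)) κ =
        inner ℝ (∫ s in a..b, (e k).eval s • f s) κ := by
  obtain ⟨v, h1, h2⟩ := hy
  let h : Fin (m + 1) → L2 Ω := fun k => (∫ s in a..b, (e k).eval s • f s) -
    ∑ i, polyIntegral a b (Polynomial.derivative (g i) * e k) • H10.val (v i) -
      polyIntegral a b (e k) • Hdiv.div qa
  have hh : ∀ k κ, inner ℝ (h k) κ = inner ℝ (∫ s in a..b, (e k).eval s • f s) κ -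
      ∑ i, polyIntegral a b (Polynomial.derivative (g i) * e k) * inner ℝ (H10.val (v i)) κ -
      polyIntegral a b (e k) * inner ℝ (Hdiv.div qa) κ := fun k κ => by
    simp only [h, inner_sub_left, sum_inner, real_inner_smul_left]
  have hya : ∀ w, A (y a) w = inner ℝ (Hdiv.div qa) (H10.val w) := fun w => by
    have h3 := Hdiv.inner_grad qa w
    rw [hqa, inner_neg_left, neg_inj] at h3
    rw [hA, h3]
  let q : Fin (m + 1) → Hdiv Ω := fun k => ⟨WithLp.toLp 2 (-M (H10.grad (v k)), h k), by
    intro φ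
    have h3 := h2 k φ.toH10
    rw [hA (v k), hya, H10.valL_apply] at h3
    simp only [H10.valL_apply] at h3
    change inner ℝ (-M (H10.grad (v k))) (H10.grad φ.toH10) = -inner ℝ (h k) (H10.val φ.toH10)
    rw [hh, inner_neg_left]
    linarith⟩
  refine ⟨v, q, h1, fun s hs => ?_, fun k κ => ?_⟩
  · have hq : ∀ k, Hdiv.valL Ω (q k) = -M (H10.gradL Ω (v k)) := fun k => rfl
    have hqa' : Hdiv.valL Ω qa = -M (H10.gradL Ω (y a)) := hqa
    rw [h1 s hs, ← Hdiv.valL_apply, ← H10.gradL_apply]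
    simp only [map_add, map_sum, map_smul, hq, hqa', neg_add, smul_neg, Finset.sum_neg_distrib]
  · change _ + inner ℝ (h k) κ = _
    rw [hh]
    ring

/-- On `[0, T]` the local solutions have a flux in `H(div; Ω)` as soon as the initial value has. -/
theorem exists_flux_of_isLocalSolution {M : L2Vec Ω →L[ℝ] L2Vec Ω}
    {A : H10 Ω →L[ℝ] H10 Ω →L[ℝ] ℝ}
    (hA : ∀ u w, A u w = inner ℝ (M (H10.grad u)) (H10.grad w))
    {f : ℝ → L2 Ω} {N m : ℕ} {T : ℝ} (hT : 0 < T) {t : Fin (N + 1) → ℝ} (ht : IsTimeMesh T t)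
    {e g : Fin N → Fin (m + 1) → Polynomial ℝ} {y : ℝ → H10 Ω}
    (hy : ∀ n, IsLocalSolution (H10.valL Ω) A f (t n.castSucc) (t n.succ) (e n) (g n) y)
    {q₀ : Hdiv Ω} (hq₀ : Hdiv.val q₀ = -M (H10.grad (y 0))) :
    ∀ s ∈ Icc 0 T, ∃ q : Hdiv Ω, Hdiv.val q = -M (H10.grad (y s)) := by
  have hmesh : ∀ k : Fin (N + 1), ∃ q : Hdiv Ω, Hdiv.val q = -M (H10.grad (y (t k))) := by
    intro k
    induction k using Fin.induction with
    | zero => exact ⟨q₀, by rw [hq₀, ht.first]⟩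
    | succ n ih =>
      obtain ⟨qa, hqa⟩ := ih
      obtain ⟨v, q, -, h, -⟩ := (hy n).exists_flux hA hqa
      exact ⟨_, h _ (right_mem_Icc.2 (ht.lt n).le)⟩
  intro s hs
  obtain ⟨n, hn⟩ := ht.exists_mem_Icc hT hs
  obtain ⟨qa, hqa⟩ := hmesh n.castSucc
  obtain ⟨v, q, -, h, -⟩ := (hy n).exists_flux hA hqa
  exact ⟨_, h s hn⟩

/-- The primal solution and its flux solve the mixed problem. -/
theorem exists_isMixedSolution {D : Euc d → Matrix (Fin d) (Fin d) ℝ} {Dm DM : ℝ}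
    (hD : IsDiffusionMatrix Ω D Dm DM) (hΩ : IsOpen Ω) {M : L2Vec Ω →L[ℝ] L2Vec Ω}
    (hM : ∀ q, ∀ᵐ x ∂(volume.restrict Ω), M q x = Matrix.toEuclideanLin (D x) (q x))
    {A : H10 Ω →L[ℝ] H10 Ω →L[ℝ] ℝ}
    (hA : ∀ u w, A u w = inner ℝ (M (H10.grad u)) (H10.grad w))
    {f : ℝ → L2 Ω} {N m : ℕ} {T : ℝ} (hT : 0 < T) {t : Fin (N + 1) → ℝ} (ht : IsTimeMesh T t)
    (hf : MemLp f 2 (volume.restrict (Ioc 0 T)))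
    {e g : Fin N → Fin (m + 1) → Polynomial ℝ}
    (heg : ∀ n, IsPetrovPair (t n.castSucc) (t n.succ) m (e n) (g n)) {y : ℝ → H10 Ω}
    (hy : ∀ n, IsLocalSolution (H10.valL Ω) A f (t n.castSucc) (t n.succ) (e n) (g n) y)
    (hflux : FluxInHdiv D (y 0)) :
    ∃ q : ℝ → Hdiv Ω, IsMixedSolution D T t (m + 1) f (y 0) (fun s => H10.val (y s)) q ∧
      ∀ s ∈ Icc 0 T, IsFlux D (q s) (y s) := by
  obtain ⟨p, hp⟩ := hflux
  have hp' : Hdiv.val (-p) = -M (H10.grad (y 0)) := by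
    change -Hdiv.val p = -M (H10.grad (y 0))
    rw [neg_inj]
    refine Lp.ext ?_
    filter_upwards [hp, hM (H10.grad (y 0))] with x h1 h2
    rw [h1, h2]
  choose! q hq using exists_flux_of_isLocalSolution hA hT ht hy hp'
  have hqflux : ∀ s ∈ Icc 0 T, IsFlux D (q s) (y s) := fun s hs => (isFlux_iff hM).2 (hq s hs)
  have hloc : ∀ n : Fin N, ∃ (v : Fin (m + 1) → H10 Ω) (c : Fin (m + 1) → Hdiv Ω),
      (∀ s ∈ Icc (t n.castSucc) (t n.succ),
        H10.val (y s) = H10.val (y (t n.castSucc)) + ∑ i, (g n i).eval s • H10.val (v i)) ∧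
      (∀ s ∈ Icc (t n.castSucc) (t n.succ),
        q s = q (t n.castSucc) + ∑ i, (g n i).eval s • c i) ∧
      ∀ k κ, ∑ i, polyIntegral (t n.castSucc) (t n.succ)
          (Polynomial.derivative (g n i) * e n k) * inner ℝ (H10.val (v i)) κ +
          polyIntegral (t n.castSucc) (t n.succ) (e n k) *
            inner ℝ (Hdiv.div (q (t n.castSucc))) κ + inner ℝ (Hdiv.div (c k)) κ =
        inner ℝ (∫ s in (t n.castSucc)..(t n.succ), (e n k).eval s • f s) κ := fun n => by
    obtain ⟨v, c, h1, h2, h3⟩ := (hy n).exists_flux hA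
      (hq _ (ht.Icc_subset n (left_mem_Icc.2 (ht.lt n).le)))
    refine ⟨v, c, fun s hs => ?_, fun s hs => ?_, h3⟩
    · rw [h1 s hs]
      simp only [← H10.valL_apply, map_add, map_sum, map_smul]
    · exact Hdiv.ext_val hΩ ((hq s (ht.Icc_subset n hs)).trans (h2 s hs).symm)
  choose v c h1 h2 h3 using hloc
  refine ⟨q, ?_, hqflux⟩
  constructor
  · exact ht.isTrial hT fun n =>
      (isPolyOn_add_sum_eval_smul (heg n).natDegree_le _ _ _).congr (h1 n)
  · exact ht.isTrial hT fun n =>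
      (isPolyOn_add_sum_eval_smul (heg n).natDegree_le _ _ _).congr (h2 n)
  · rfl
  · exact hqflux 0 (left_mem_Icc.2 hT.le)
  · intro w hw
    let B : Hdiv Ω →L[ℝ] L2 Ω →L[ℝ] ℝ := (innerSL ℝ : L2 Ω →L[ℝ] L2 Ω →L[ℝ] ℝ) ∘L Hdiv.divL Ω
    refine (ht.add_integral_eq fun n => ?_).2.2
    exact (heg n).integral_eq (ht.lt n) (ContinuousLinearMap.id ℝ (L2 Ω)) B
      (fun s hs => deriv_of_eq_add_sum (h1 n) hs)
      (fun s hs => h2 n s (Ioo_subset_Icc_self hs)) (hw.2 n) (ht.intervalIntegrable hf n) (h3 n)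
  · intro w _
    rw [sub_eq_zero]
    refine intervalIntegral.integral_congr fun s hs => ?_
    rw [uIcc_of_le hT.le] at hs
    exact (hqflux s hs).invForm_eq hD (w s)

end Mixed

end CGPMixed

open CGPMixed
theorem mainTheorem5 {d : ℕ} (hd : d = 2 ∨ d = 3)
    (Ω : Set (Euc d)) (hΩ_open : IsOpen Ω) (hΩ_conn : IsConnected Ω)
    (hΩ_bdd : Bornology.IsBounded Ω)
    (D : Euc d → Matrix (Fin d) (Fin d) ℝ) (Dm DM : ℝ) (hD : IsDiffusionMatrix Ω D Dm DM)
    (T : ℝ) (hT : 0 < T) (N : ℕ) (t : Fin (N + 1) → ℝ) (ht : IsTimeMesh T t)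
    (r : ℕ) (hr : 1 ≤ r)
    (f : ℝ → L2 Ω) (hf : MemLp f 2 (volume.restrict (Ioc 0 T)))
    (u₀ : H10 Ω) :
    (∃ z : ℝ → H10 Ω, IsShiftedPrimalSolution D T t r f u₀ z) ∧
    (∃ y : ℝ → H10 Ω, IsPrimalSolution D T t r f u₀ y) ∧
    (FluxInHdiv D u₀ →
      ∃ (u : ℝ → L2 Ω) (q : ℝ → Hdiv Ω), IsMixedSolution D T t r f u₀ u q ∧
        ∃ y : ℝ → H10 Ω, IsPrimalSolution D T t r f u₀ y ∧
          ∀ s ∈ Icc 0 T, u s = H10.val (y s) ∧ IsFlux D (q s) (y s)) := by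
  obtain ⟨m, rfl⟩ : ∃ m, r = m + 1 := ⟨r - 1, by omega⟩
  obtain ⟨M, hM⟩ := hD.exists_operator
  let A : H10 Ω →L[ℝ] H10 Ω →L[ℝ] ℝ :=
    (innerSL ℝ : L2Vec Ω →L[ℝ] L2Vec Ω →L[ℝ] ℝ).bilinearComp (M ∘L H10.gradL Ω) (H10.gradL Ω)
  have hA : ∀ u w, A u w = inner ℝ (M (H10.grad u)) (H10.grad w) := fun u w => rfl
  have hAa : ∀ u w, A u w = aForm D u w := fun u w => (aForm_eq_inner hM u w).symm
  have hcoer : IsCoercive A := hD.isCoercive (by omega) hΩ_open hΩ_bdd hAa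
  choose e g heg using fun n : Fin N => exists_isPetrovPair (ht.lt n) m
  obtain ⟨y, hy0, hy⟩ := exists_timeStepping ht.strictMono
    (fun n y => IsLocalSolution (H10.valL Ω) A f (t n.castSucc) (t n.succ) (e n) (g n) y)
    (fun n y z hyz h => h.congr (ht.lt n).le hyz)
    (fun n x => exists_isLocalSolution (H10.valL Ω) A hcoer f (heg n) x) u₀
  rw [ht.first] at hy0
  have hpoly : ∀ n : Fin N, IsPolyOn (m + 1) (Icc (t n.castSucc) (t n.succ)) y := fun n =>
    (hy n).isPolyOn (heg n)
  have hprimal : IsPrimalSolution D T t (m + 1) f u₀ y := by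
    refine ⟨ht.isTrial hT hpoly, hy0, fun w hw => ?_⟩
    have := (integral_eq_of_isLocalSolution ht hf heg hy hw).2.2
    simpa only [hAa, H10.valL_apply] using this
  refine ⟨⟨fun s => y s - u₀, ?_, ?_, fun w hw => ?_⟩, ⟨y, hprimal⟩, fun hflux => ?_⟩
  · refine ht.isTrial hT fun n => ?_
    obtain ⟨v, h, -⟩ := hy n
    refine (isPolyOn_add_sum_eval_smul (heg n).natDegree_le _ (y (t n.castSucc) - u₀) v).congr
      fun s hs => ?_
    simp only [h s hs]
    abel
  · simp only [hy0, sub_self]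
  · obtain ⟨hq, hh, heq⟩ := integral_eq_of_isLocalSolution ht hf heg hy hw
    have hw₀ : IntervalIntegrable (fun s => A u₀ (w s)) volume 0 T := by
      rw [intervalIntegrable_iff_integrableOn_Ioc_of_le hT.le]
      exact (A u₀).integrable_comp (hw.1.integrable (by norm_num))
    have hz : deriv (fun s => y s - u₀) = deriv y := funext fun s => deriv_sub_const _
    simp only [hz, ← hAa, map_sub, sub_apply, ← H10.valL_apply]
    rw [intervalIntegral.integral_sub hq hw₀, intervalIntegral.integral_sub hh hw₀, ← heq]
    ring
  · rw [← hy0] at hflux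
    obtain ⟨q, hq, hqf⟩ := exists_isMixedSolution hD hΩ_open hM hA hT ht hf heg hy hflux
    rw [hy0] at hq
    exact ⟨_, q, hq, y, hprimal, fun s hs => ⟨rfl, hqf s hs⟩⟩
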